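/- All complex Lie groups are finite-dimensional, Hausdorff and second countable. For a complex manifold $M$ let $\mathcal O(M)$ be the space of holomorphic functions on $M$ with the topology of uniform convergence on compact sets, and let $\mathscr A(M)$ be its strong dual (continuous linear functionals, with the topology of uniform convergence on bounded sets). If $G$ is a complex Lie group, $\mathscr A(G)$ carries the convolution product $\langle\alpha\beta,f\rangle=\langle\alpha,\,g\mapsto\langle\beta,\,h\mapsto f(gh)\rangle\rangle$, with unit $\delta_e$. A $\widehat\otimes$-algebra is a unital complete Hausdorff locally convex algebra over $\mathbb C$ with jointly continuous multiplication; a $\widehat\otimes$-bimodule over $\widehat\otimes$-algebras is a complete Hausdorff locally convex unital bimodule whose actions are jointly continuous. For a $\widehat\otimes$-algebra $R$, an $R$-$\widehat\otimes$-algebra is a $\widehat\otimes$-algebra $A$ together with a continuous unital homomorphism $\eta\colon R\to A$. It is called relatively homologically trivial if $A$ is projective in the relative category $(A,R)\text{-}\mathrm{mod}\text{-}(A,R)$, that is: whenever $\pi\colon Y\to Z$ is a continuous morphism of $A$-$\widehat\otimes$-bimodules that has a continuous right inverse which is a morphism of $R$-bimodules, every continuous morphism of $A$-bimodules $A\to Z$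 lifts through $\pi$ to a continuous morphism of $A$-bimodules $A\to Y$. A complex Lie group $L$ is called linearly complex reductive if there are a compact real Lie group $K$ and a morphism of real Lie groups $K\to L$ that makes $L$ the universal complexification of $K$: every morphism of real Lie groups from $K$ to a complex Lie group $H$ factors through $K\to L$ by a unique holomorphic homomorphism $L\to H$. **Theorem.** Let $G$ be a complex Lie group of the form $G=N\rtimes L$, where $N$ and $L$ are complex Lie groups, the map $N\times L\to G$, $(n,l)\mapsto nl$, is biholomorphic, and $L$ is linearly complex reductive. Then $\mathscr A(N)$ and $\mathscr A(G)$ are $\widehat\otimes$-algebras, the homomorphism $\mathscr A(N)\to\mathscr A(G)$ induced by the inclusion $N\to G$ is continuous, and the $\mathscr A(N)$-$\widehat\otimes$-algebra $\mathscr A(G)$ is relatively homologically trivial. -/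

import Mathlib

open scoped Manifold ContDiff Topology

section Aux
open Set Metric Filter

/-- Second order Cauchy estimate. -/
theorem holAux_taylor {E : Type*} [NormedAddCommGroup E] [NormedSpace ℂ E] {f : E → ℂ} {x₀ : E}
    {δ M : ℝ} (hδ : 0 < δ) (hf : DifferentiableOn ℂ f (ball x₀ δ))
    (hM : ∀ x ∈ ball x₀ δ, ‖f x‖ ≤ M) {v : E} (hv : ‖v‖ < δ) :
    ‖f (x₀ + v) - f x₀ - fderiv ℂ f x₀ v‖ ≤ 4 * M / δ ^ 2 * ‖v‖ ^ 2 := by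
  rcases eq_or_ne v 0 with rfl | hv0
  · simp
  have hnv : 0 < ‖v‖ := norm_pos_iff.2 hv0
  set R : ℝ := δ / ‖v‖ with hR
  have hR1 : 1 < R := (one_lt_div hnv).2 hv
  have hR0 : 0 < R := by linarith
  set g : ℂ → ℂ := fun t => f (x₀ + t • v) with hg
  have hmaps : ∀ t ∈ ball (0 : ℂ) R, x₀ + t • v ∈ ball x₀ δ := by
    intro t ht
    rw [mem_ball_zero_iff] at ht
    rw [mem_ball, dist_eq_norm, add_sub_cancel_left, norm_smul]
    calc ‖t‖ * ‖v‖ < R * ‖v‖ := by gcongr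
      _ = δ := by rw [hR]; field_simp
  have hgd : DifferentiableOn ℂ g (ball 0 R) :=
    hf.comp (by fun_prop) hmaps
  have hx0 : ‖f x₀‖ ≤ M := hM _ (mem_ball_self hδ)
  have h1 : MapsTo g (ball 0 R) (closedBall (g 0) (2 * M)) := by
    intro t ht
    rw [mem_closedBall, dist_eq_norm]
    calc ‖g t - g 0‖ ≤ ‖g t‖ + ‖g 0‖ := norm_sub_le _ _
      _ ≤ M + M := add_le_add (hM _ (hmaps t ht)) (by simpa [hg] using hx0)
      _ = 2 * M := by ring
  set q := dslope g 0 with hq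
  have hqd : DifferentiableOn ℂ q (ball 0 R) :=
    (Complex.differentiableOn_dslope (ball_mem_nhds _ hR0)).2 hgd
  have h2 : ∀ t ∈ ball (0 : ℂ) R, ‖q t‖ ≤ 2 * M / R := fun t ht =>
    Complex.norm_dslope_le_div_of_mapsTo_ball hgd h1 ht
  have h3 : MapsTo q (ball 0 R) (closedBall (q 0) (2 * (2 * M / R))) := by
    intro t ht
    rw [mem_closedBall, dist_eq_norm]
    calc ‖q t - q 0‖ ≤ ‖q t‖ + ‖q 0‖ := norm_sub_le _ _
      _ ≤ 2 * M / R + 2 * M / R := add_le_add (h2 t ht) (h2 0 (mem_ball_self hR0))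
      _ = 2 * (2 * M / R) := by ring
  have h4 := Complex.norm_dslope_le_div_of_mapsTo_ball hqd h3
    (show (1 : ℂ) ∈ ball (0 : ℂ) R by simpa using hR1)
  have hder : deriv g 0 = fderiv ℂ f x₀ v := by
    have hfd : HasFDerivAt f (fderiv ℂ f x₀) (x₀ + (0 : ℂ) • v) := by
      simpa using (hf.differentiableAt (ball_mem_nhds _ hδ)).hasFDerivAt
    have hl : HasDerivAt (fun t : ℂ => x₀ + t • v) v 0 := by
      simpa using ((hasDerivAt_id (0 : ℂ)).smul_const v).const_add x₀
    exact (hfd.comp_hasDerivAt (0 : ℂ) hl).deriv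
  have h5 : dslope q 0 1 = f (x₀ + v) - f x₀ - fderiv ℂ f x₀ v := by
    rw [dslope_of_ne _ one_ne_zero, slope_def_field, hq, dslope_of_ne _ one_ne_zero,
      slope_def_field, dslope_same, hder]
    simp [hg]
  rw [h5] at h4
  refine h4.trans (le_of_eq ?_)
  rw [hR]
  field_simp
  ring

/-- A continuous family of holomorphic functions of `x`, viewed as a function of `x` with values in
a space of continuous functions, is holomorphic after applying a continuous linear functional. -/
theorem holAux_differentiableAt {E : Type*} [NormedAddCommGroup E] [NormedSpace ℂ E]
    [FiniteDimensional ℂ E] {X : Type*} [TopologicalSpace X] (p : E → C(X, ℂ)) {U : Set E}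
    (hU : IsOpen U) {x₀ : E} (hx₀ : x₀ ∈ U)
    (hcont : ContinuousOn (fun z : E × X => p z.1 z.2) (U ×ˢ univ))
    (hdiff : ∀ h, DifferentiableOn ℂ (fun x => p x h) U) (b : C(X, ℂ) →L[ℂ] ℂ) :
    DifferentiableAt ℂ (fun x => b (p x)) x₀ := by
  -- local bounds
  have hloc : ∀ K : Set X, IsCompact K → ∃ δ > 0, ∃ M : ℝ, ∃ W : Set X, IsOpen W ∧ K ⊆ W ∧
      ball x₀ δ ⊆ U ∧ ∀ x ∈ ball x₀ δ, ∀ h ∈ W, ‖p x h‖ ≤ M := by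
    intro K hK
    obtain ⟨M, hM⟩ := hK.exists_bound_of_continuousOn (f := p x₀) (p x₀).continuous.continuousOn
    have hO : IsOpen {z : E × X | z ∈ U ×ˢ (univ : Set X) ∧ ‖p z.1 z.2‖ < M + 1} := by
      have := hcont.norm.isOpen_inter_preimage (hU.prod isOpen_univ) (isOpen_Iio (a := M + 1))
      exact this
    obtain ⟨u, w, hu, hw, hxu, hKw, huw⟩ := generalized_tube_lemma (isCompact_singleton (x := x₀))
      hK hO (by
        rintro ⟨x, h⟩ ⟨hx, hh⟩
        rw [mem_singleton_iff] at hx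
        subst hx
        exact ⟨⟨hx₀, mem_univ _⟩, (hM h hh).trans_lt (lt_add_one M)⟩)
    obtain ⟨δ, hδ, hb⟩ := Metric.isOpen_iff.1 (hu.inter hU) x₀ ⟨hxu rfl, hx₀⟩
    exact ⟨δ, hδ, M + 1, w, hw, hKw, fun x hx => (hb hx).2,
      fun x hx h hh => (huw (mk_mem_prod (hb hx).1 hh)).2.le⟩
  -- the derivative
  have hDc : ∀ v, Continuous fun h => fderiv ℂ (fun x => p x h) x₀ v := by
    intro v
    rw [continuous_iff_continuousAt]
    intro h₀
    obtain ⟨δ, hδ, M, W, hW, hKW, hbU, hbd⟩ := hloc {h₀} isCompact_singleton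
    have hWn : W ∈ 𝓝 h₀ := hW.mem_nhds (hKW rfl)
    refine continuousAt_of_locally_uniform_approx_of_continuousAt fun u hu => ?_
    obtain ⟨ε, hε, hu⟩ := Metric.mem_uniformity_dist.1 hu
    have hlim : Tendsto (fun t : ℝ => 4 * M / δ ^ 2 * (t * ‖v‖ ^ 2)) (𝓝[>] 0) (𝓝 0) := by
      have : Tendsto (fun t : ℝ => 4 * M / δ ^ 2 * (t * ‖v‖ ^ 2)) (𝓝 0)
          (𝓝 (4 * M / δ ^ 2 * (0 * ‖v‖ ^ 2))) := by
        apply Continuous.tendsto; fun_prop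
      simpa using this.mono_left nhdsWithin_le_nhds
    have hlim2 : Tendsto (fun t : ℝ => t * ‖v‖) (𝓝[>] 0) (𝓝 0) := by
      have : Tendsto (fun t : ℝ => t * ‖v‖) (𝓝 0) (𝓝 (0 * ‖v‖)) := by
        apply Continuous.tendsto; fun_prop
      simpa using this.mono_left nhdsWithin_le_nhds
    obtain ⟨t, ⟨ht1, ht2⟩, ht0⟩ := (((hlim.eventually (gt_mem_nhds hε)).and
      (hlim2.eventually (gt_mem_nhds hδ))).and self_mem_nhdsWithin).exists
    have ht0 : 0 < t := ht0
    refine ⟨W, hWn, fun h => (t : ℂ)⁻¹ * (p (x₀ + (t : ℂ) • v) h - p x₀ h), ?_, ?_⟩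
    · exact (by fun_prop : Continuous _).continuousAt
    · intro h hh
      apply hu
      have := holAux_taylor hδ ((hdiff h).mono hbU) (fun x hx => hbd x hx h hh)
        (v := (t : ℂ) • v) (by simpa [norm_smul, abs_of_pos ht0] using ht2)
      rw [dist_comm, dist_eq_norm]
      have htc : (t : ℂ) ≠ 0 := by exact_mod_cast ht0.ne'
      have key : (t : ℂ)⁻¹ * (p (x₀ + (t : ℂ) • v) h - p x₀ h) - fderiv ℂ (fun x => p x h) x₀ v
          = (t : ℂ)⁻¹ * (p (x₀ + (t : ℂ) • v) h - p x₀ h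
            - fderiv ℂ (fun x => p x h) x₀ ((t : ℂ) • v)) := by
        rw [map_smul, smul_eq_mul]; field_simp
      rw [key, norm_mul, norm_inv, Complex.norm_real, Real.norm_of_nonneg ht0.le]
      refine lt_of_le_of_lt ?_ ht1
      rw [inv_mul_le_iff₀ ht0]
      refine this.trans (le_of_eq ?_)
      rw [norm_smul, Complex.norm_real, Real.norm_of_nonneg ht0.le]
      ring
  let D : E →ₗ[ℂ] C(X, ℂ) :=
    { toFun := fun v => ⟨fun h => fderiv ℂ (fun x => p x h) x₀ v, hDc v⟩
      map_add' := fun v w => by ext h; simp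
      map_smul' := fun c v => by ext h; simp }
  let T : E →L[ℂ] ℂ := LinearMap.toContinuousLinearMap (b.toLinearMap ∘ₗ D)
  suffices HasFDerivAt (fun x => b (p x)) T x₀ from this.differentiableAt
  rw [hasFDerivAt_iff_tendsto]
  have hC : Tendsto (fun x => ((‖x - x₀‖⁻¹ : ℝ) : ℂ) • (p x - p x₀ - D (x - x₀))) (𝓝 x₀)
      (𝓝 (0 : C(X, ℂ))) := by
    rw [ContinuousMap.tendsto_iff_forall_isCompact_tendstoUniformlyOn]
    intro K hK
    obtain ⟨δ, hδ, M, W, hW, hKW, hbU, hbd⟩ := hloc K hK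
    rw [Metric.tendstoUniformlyOn_iff]
    intro ε hε
    have hlim : Tendsto (fun x => 4 * M / δ ^ 2 * ‖x - x₀‖) (𝓝 x₀) (𝓝 0) := by
      have : Tendsto (fun x => 4 * M / δ ^ 2 * ‖x - x₀‖) (𝓝 x₀)
          (𝓝 (4 * M / δ ^ 2 * ‖x₀ - x₀‖)) := by
        apply Continuous.tendsto; fun_prop
      simpa using this
    filter_upwards [hlim.eventually (gt_mem_nhds hε), ball_mem_nhds x₀ hδ] with x hx hxb h hh
    have := holAux_taylor hδ ((hdiff h).mono hbU) (fun x hx => hbd x hx h (hKW hh))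
      (v := x - x₀) (by simpa [dist_eq_norm] using hxb)
    rw [add_sub_cancel] at this
    rw [dist_eq_norm, ContinuousMap.zero_apply, zero_sub, norm_neg]
    refine lt_of_le_of_lt ?_ hx
    change ‖((‖x - x₀‖⁻¹ : ℝ) : ℂ) * (p x h - p x₀ h - fderiv ℂ (fun x => p x h) x₀ (x - x₀))‖ ≤ _
    rw [norm_mul, Complex.norm_real, norm_inv, norm_norm]
    rcases eq_or_ne x x₀ with rfl | hne
    · simp
    · rw [inv_mul_le_iff₀ (norm_pos_iff.2 (sub_ne_zero.2 hne))]
      exact this.trans (le_of_eq (by ring))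
  have hb := (b.continuous.tendsto 0).comp hC
  rw [map_zero] at hb
  have hn := hb.norm
  rw [norm_zero] at hn
  refine hn.congr fun x => ?_
  have hT : T (x - x₀) = b (D (x - x₀)) := rfl
  rw [Function.comp_apply, map_smul, map_sub, map_sub, hT, norm_smul, Complex.norm_real, norm_inv,
    norm_norm]

end Aux

open scoped ComplexOrder in
theorem holAux_polynormable (X : Type*) [TopologicalSpace X] : PolynormableSpace ℂ C(X, ℂ) := by
  have : LocallyConvexSpace ℂ ℂ :=
    LocallyConvexSpace.ofBases ℂ ℂ (fun x r => Metric.ball x r) (fun _ r => 0 < r)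
      (fun _ => Metric.nhds_basis_ball) fun x r _ =>
        convex_of_nonneg_surjective_algebraMap (R := ℝ) _
          (fun z hz => by
            obtain ⟨y, hy, rfl⟩ := (RCLike.nonneg_iff_exists_ofReal (K := ℂ)).mp (Set.mem_Ici.1 hz)
            exact ⟨y, hy, rfl⟩) (convex_ball x r)
  infer_instance

/-! ### Holomorphic functions and analytic functionals -/

/-- The linear space of holomorphic (i.e. complex differentiable) functions on the complex manifold
`M` modelled on `E`, as a subspace of `C(M, ℂ)`. -/
def holSubmodule (E : Type*) [NormedAddCommGroup E] [NormedSpace ℂ E]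
    (M : Type*) [TopologicalSpace M] [ChartedSpace E M] : Submodule ℂ C(M, ℂ) where
  carrier := {f | MDifferentiable 𝓘(ℂ, E) 𝓘(ℂ, ℂ) f}
  add_mem' hf hg := MDifferentiable.add hf hg
  zero_mem' := mdifferentiable_const
  smul_mem' c _ hf := MDifferentiable.const_smul c hf

/-- `𝒪(M)`: the locally convex space of holomorphic functions on the complex manifold `M` modelled
on `E`, with the topology of uniform convergence on compact subsets (the topology induced from
`C(M, ℂ)`). -/
def HolFun (E : Type*) [NormedAddCommGroup E] [NormedSpace ℂ E]
    (M : Type*) [TopologicalSpace M] [ChartedSpace E M] : Type _ :=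
  holSubmodule E M

namespace HolFun

variable {E : Type*} [NormedAddCommGroup E] [NormedSpace ℂ E]
  {M : Type*} [TopologicalSpace M] [ChartedSpace E M]

noncomputable instance : AddCommGroup (HolFun E M) :=
  inferInstanceAs (AddCommGroup (holSubmodule E M))

noncomputable instance : Module ℂ (HolFun E M) :=
  inferInstanceAs (Module ℂ (holSubmodule E M))

noncomputable instance : UniformSpace (HolFun E M) :=
  inferInstanceAs (UniformSpace (holSubmodule E M))

instance : IsTopologicalAddGroup (HolFun E M) :=
  inferInstanceAs (IsTopologicalAddGroup (holSubmodule E M))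

instance : ContinuousSMul ℂ (HolFun E M) :=
  inferInstanceAs (ContinuousSMul ℂ (holSubmodule E M))

end HolFun

/-- `𝒜(M)`: the strong dual of `𝒪(M)`, i.e. the continuous linear functionals on `𝒪(M)` with the
topology of uniform convergence on bounded subsets (which is the topology that Mathlib puts on
spaces of continuous linear maps). -/
def AnFun (E : Type*) [NormedAddCommGroup E] [NormedSpace ℂ E]
    (M : Type*) [TopologicalSpace M] [ChartedSpace E M] : Type _ :=
  HolFun E M →L[ℂ] ℂ

namespace AnFun

section Space

variable {E : Type*} [NormedAddCommGroup E] [NormedSpace ℂ E]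
  {M : Type*} [TopologicalSpace M] [ChartedSpace E M]

noncomputable instance : AddCommGroup (AnFun E M) :=
  inferInstanceAs (AddCommGroup (HolFun E M →L[ℂ] ℂ))

noncomputable instance : Module ℂ (AnFun E M) :=
  inferInstanceAs (Module ℂ (HolFun E M →L[ℂ] ℂ))

noncomputable instance : UniformSpace (AnFun E M) :=
  inferInstanceAs (UniformSpace (HolFun E M →L[ℂ] ℂ))

noncomputable instance : FunLike (AnFun E M) (HolFun E M) ℂ :=
  inferInstanceAs (FunLike (HolFun E M →L[ℂ] ℂ) (HolFun E M) ℂ)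

/-- The evaluation functional `δ_x : f ↦ f x`. -/
noncomputable def delta (x : M) : AnFun E M :=
  ({ toFun := fun f => f.1 x
     map_add' := fun _ _ => rfl
     map_smul' := fun _ _ => rfl
     cont := (ContinuousEvalConst.continuous_eval_const x).comp continuous_subtype_val } :
    HolFun E M →L[ℂ] ℂ)

end Space

section Group

variable {E : Type*} [NormedAddCommGroup E] [NormedSpace ℂ E] [FiniteDimensional ℂ E]
  {G : Type*} [TopologicalSpace G] [ChartedSpace E G] [Group G] [LieGroup 𝓘(ℂ, E) ω G]

/-- For `f ∈ 𝒪(G)` and `g ∈ G`, the holomorphic function `h ↦ f (g * h)`. -/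
noncomputable def translate (f : HolFun E G) (g : G) : HolFun E G :=
  have := continuousMul_of_contMDiffMul 𝓘(ℂ, E) ω (G := G)
  ⟨⟨fun h => f.1 (g * h), f.1.continuous.comp (continuous_const_mul g)⟩,
    MDifferentiable.comp (I' := 𝓘(ℂ, E)) (f := fun h => g * h) f.2
      ((contMDiff_mul_left (I := 𝓘(ℂ, E)) (n := ω)).mdifferentiable (by simp))⟩

set_option linter.unusedSectionVars false in
theorem continuous_translate_uncurry (f : HolFun E G) :
    Continuous fun z : G × G => f.1 (z.1 * z.2) :=
  have := continuousMul_of_contMDiffMul 𝓘(ℂ, E) ω (G := G)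
  f.1.continuous.comp continuous_mul

theorem continuous_translate (f : HolFun E G) : Continuous (translate f) :=
  Continuous.subtype_mk
    (ContinuousMap.curry ⟨_, continuous_translate_uncurry f⟩).continuous _

theorem mdifferentiable_apply_translate (b : AnFun E G) (f : HolFun E G) :
    MDifferentiable 𝓘(ℂ, E) 𝓘(ℂ, ℂ) fun g => b (translate f g) := by
  have hmul := continuousMul_of_contMDiffMul 𝓘(ℂ, E) ω (G := G)
  have : IsManifold 𝓘(ℂ, E) 1 G := IsManifold.of_le (n := ω) (by simp)
  have := holAux_polynormable G
  obtain ⟨b', hb'⟩ :=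
    StrongDual.exists_extension (holSubmodule E G) (show HolFun E G →L[ℂ] ℂ from b)
  intro g₀
  rw [mdifferentiableAt_iff]
  refine ⟨((show HolFun E G →L[ℂ] ℂ from b).continuous.comp (continuous_translate f)).continuousAt,
    ?_⟩
  have hc := continuousOn_extChartAt_symm (I := 𝓘(ℂ, E)) g₀
  have hs : MDifferentiableOn 𝓘(ℂ, E) 𝓘(ℂ, E) (extChartAt 𝓘(ℂ, E) g₀).symm
      (extChartAt 𝓘(ℂ, E) g₀).target :=
    (contMDiffOn_extChartAt_symm (I := 𝓘(ℂ, E)) (n := 1) g₀).mdifferentiableOn (by simp)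
  have key := holAux_differentiableAt
    (fun x => (translate f ((extChartAt 𝓘(ℂ, E) g₀).symm x)).1)
    (isOpen_extChartAt_target (I := 𝓘(ℂ, E)) g₀) (mem_extChartAt_target (I := 𝓘(ℂ, E)) g₀)
    ((continuous_translate_uncurry f).comp_continuousOn
      ((hc.comp continuousOn_fst fun z hz => hz.1).prodMk continuousOn_snd))
    (fun h => by
      rw [← mdifferentiableOn_iff_differentiableOn]
      have h1 : MDifferentiable 𝓘(ℂ, E) 𝓘(ℂ, E) fun g : G => g * h :=
        (contMDiff_mul_right (I := 𝓘(ℂ, E)) (n := ω)).mdifferentiable (by simp)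
      exact (MDifferentiable.comp (I' := 𝓘(ℂ, E)) (f := fun g => g * h) f.2 h1).comp_mdifferentiableOn hs)
    b'
  refine (key.congr_of_eventuallyEq (Filter.Eventually.of_forall fun x => ?_)).differentiableWithinAt
  exact (hb' _).symm

/-- The operator `f ↦ (g ↦ ⟨b, f (g ·)⟩)` on `𝒪(G)`, i.e. `(id ⊗ b) ∘ Δ` for the comultiplication
`Δ f (g, h) = f (g * h)`. -/
noncomputable def slice (b : AnFun E G) : HolFun E G →L[ℂ] HolFun E G where
  toFun f := ⟨⟨fun g => b (translate f g),
    (show HolFun E G →L[ℂ] ℂ from b).continuous.comp (continuous_translate f)⟩,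
    mdifferentiable_apply_translate b f⟩
  map_add' f₁ f₂ := by
    apply Subtype.ext
    ext g
    exact map_add (show HolFun E G →L[ℂ] ℂ from b) (translate f₁ g) (translate f₂ g)
  map_smul' c f := by
    apply Subtype.ext
    ext g
    exact map_smul (show HolFun E G →L[ℂ] ℂ from b) c (translate f g)
  cont := by
    have := continuousMul_of_contMDiffMul 𝓘(ℂ, E) ω (G := G)
    have : LocallyCompactSpace G := Manifold.locallyCompact_of_finiteDimensional 𝓘(ℂ, E)
    refine Continuous.subtype_mk ?_ _
    apply ContinuousMap.continuous_of_continuous_uncurry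
    refine (show HolFun E G →L[ℂ] ℂ from b).continuous.comp (Continuous.subtype_mk ?_ _)
    apply ContinuousMap.continuous_of_continuous_uncurry
    change Continuous fun z : (HolFun E G × G) × G => z.1.1.1 (z.1.2 * z.2)
    have h1 : Continuous fun z : (HolFun E G × G) × G => (z.1.1.1, z.1.2 * z.2) := by fun_prop
    exact ContinuousEval.continuous_eval.comp h1

/-- Convolution of analytic functionals:
`⟨a * b, f⟩ = (a ⊗ b) (Δ f) = ⟨a, g ↦ ⟨b, h ↦ f (g * h)⟩⟩`. -/
noncomputable instance : Mul (AnFun E G) :=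
  ⟨fun a b => (show HolFun E G →L[ℂ] ℂ from a).comp (slice b)⟩

theorem mul_apply (a b : AnFun E G) (f : HolFun E G) : (a * b) f = a (slice b f) := rfl

/-- The unit of the convolution algebra is the delta functional at the identity. -/
noncomputable instance : One (AnFun E G) := ⟨delta 1⟩

noncomputable instance : Ring (AnFun E G) where
  __ := (inferInstance : AddCommGroup (AnFun E G))
  __ := (inferInstance : Mul (AnFun E G))
  __ := (inferInstance : One (AnFun E G))
  left_distrib a b c := by
    apply DFunLike.ext
    intro f
    exact map_add (show HolFun E G →L[ℂ] ℂ from a) (slice b f) (slice c f)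
  right_distrib a b c := rfl
  zero_mul a := rfl
  mul_zero a := by
    apply DFunLike.ext
    intro f
    exact map_zero (show HolFun E G →L[ℂ] ℂ from a)
  mul_assoc a b c := by
    apply DFunLike.ext
    intro f
    refine congrArg (fun u => a u) ?_
    apply Subtype.ext
    ext g
    refine congrArg (fun u => b u) ?_
    apply Subtype.ext
    ext h
    refine congrArg (fun u => c u) ?_
    apply Subtype.ext
    ext k
    exact congrArg f.1 (mul_assoc g h k)
  one_mul a := by
    apply DFunLike.ext
    intro f
    refine congrArg (fun u => a u) ?_
    apply Subtype.ext
    ext h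
    exact congrArg f.1 (one_mul h)
  mul_one a := by
    apply DFunLike.ext
    intro f
    refine congrArg (fun u => a u) ?_
    apply Subtype.ext
    ext h
    exact congrArg f.1 (mul_one h)

noncomputable instance : Algebra ℂ (AnFun E G) :=
  Algebra.ofModule (fun _ _ _ => rfl) fun c a b => by
    apply DFunLike.ext
    intro f
    exact map_smul (show HolFun E G →L[ℂ] ℂ from a) c (slice b f)

variable {E' : Type*} [NormedAddCommGroup E'] [NormedSpace ℂ E'] [FiniteDimensional ℂ E']
  {G' : Type*} [TopologicalSpace G'] [ChartedSpace E' G'] [Group G'] [LieGroup 𝓘(ℂ, E') ω G']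

/-- Composition with a holomorphic homomorphism `ι : G → G'`, as a continuous linear operator
`𝒪(G') → 𝒪(G)`. -/
noncomputable def pullback (ι : G →* G') (hι : MDifferentiable 𝓘(ℂ, E) 𝓘(ℂ, E') ι) :
    HolFun E' G' →L[ℂ] HolFun E G where
  toFun f := ⟨f.1.comp ⟨ι, hι.continuous⟩, MDifferentiable.comp (I' := 𝓘(ℂ, E')) (f := ι) f.2 hι⟩
  map_add' _ _ := rfl
  map_smul' _ _ := rfl
  cont := Continuous.subtype_mk
    ((ContinuousMap.continuous_precomp _).comp continuous_subtype_val) _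

/-- The homomorphism of convolution algebras `𝒜(G) → 𝒜(G')` induced by a holomorphic homomorphism
`ι : G → G'`: `⟨ι_* a, f⟩ = ⟨a, f ∘ ι⟩`. -/
noncomputable def map (ι : G →* G') (hι : MDifferentiable 𝓘(ℂ, E) 𝓘(ℂ, E') ι) :
    AnFun E G →ₐ[ℂ] AnFun E' G' :=
  AlgHom.ofLinearMap
    { toFun := fun a => (show HolFun E G →L[ℂ] ℂ from a).comp (pullback ι hι)
      map_add' := fun _ _ => rfl
      map_smul' := fun _ _ => rfl }
    (by
      apply DFunLike.ext
      intro f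
      exact congrArg f.1 (map_one ι))
    (fun a b => by
      apply DFunLike.ext
      intro f
      refine congrArg (fun u => a u) ?_
      apply Subtype.ext
      ext g
      refine congrArg (fun u => b u) ?_
      apply Subtype.ext
      ext h
      exact congrArg f.1 (map_mul ι g h))

end Group

end AnFun

/-! ### Complete locally convex algebras and bimodules, relative projectivity -/

/-- Complete (Hausdorff) complex locally convex spaces. -/
structure IsCompleteLCS (V : Type*) [AddCommGroup V] [Module ℂ V] [UniformSpace V] : Prop where
  isUniformAddGroup : IsUniformAddGroup V
  continuousSMul : ContinuousSMul ℂ V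
  locallyConvexSpace : LocallyConvexSpace ℝ V
  t2Space : T2Space V
  completeSpace : CompleteSpace V

/-- `⊗̂`-algebras: unital complete locally convex algebras with jointly continuous
multiplication. -/
structure IsHatAlgebra (A : Type*) [Ring A] [Algebra ℂ A] [UniformSpace A] : Prop
    extends IsCompleteLCS A where
  continuous_mul : Continuous fun p : A × A => p.1 * p.2

/-- `A`-`B`-`⊗̂`-bimodules: complete locally convex spaces with commuting unital actions of `A` on
the left and of `B` on the right (written as a left action of the opposite algebra) which are
compatible with the complex structure and jointly continuous. -/
structure IsHatBimodule (A B X : Type*) [Ring A] [Algebra ℂ A] [UniformSpace A]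
    [Ring B] [Algebra ℂ B] [UniformSpace B] [AddCommGroup X] [Module ℂ X] [UniformSpace X]
    [Module A X] [Module Bᵐᵒᵖ X] : Prop extends IsCompleteLCS X where
  smulCommClass : SMulCommClass A Bᵐᵒᵖ X
  isScalarTower_left : IsScalarTower ℂ A X
  isScalarTower_right : IsScalarTower ℂ Bᵐᵒᵖ X
  continuous_left : Continuous fun p : A × X => p.1 • p.2
  continuous_right : Continuous fun p : X × B => MulOpposite.op p.2 • p.1

/-- `f` is a morphism of `R`-`S`-bimodules, where `R` and `S` act on the `A`-`B`-bimodules `X` and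
`Y` through `η : R → A` and `θ : S → B`. -/
def IsBimoduleMap {R S A B X Y : Type*} [Ring R] [Algebra ℂ R] [Ring S] [Algebra ℂ S]
    [Ring A] [Algebra ℂ A] [Ring B] [Algebra ℂ B]
    [AddCommGroup X] [Module ℂ X] [UniformSpace X] [Module A X] [Module Bᵐᵒᵖ X]
    [AddCommGroup Y] [Module ℂ Y] [UniformSpace Y] [Module A Y] [Module Bᵐᵒᵖ Y]
    (η : R →ₐ[ℂ] A) (θ : S →ₐ[ℂ] B) (f : X →L[ℂ] Y) : Prop :=
  (∀ (r : R) (x : X), f (η r • x) = η r • f x) ∧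
    ∀ (s : S) (x : X), f (MulOpposite.op (θ s) • x) = MulOpposite.op (θ s) • f x

/-- Projectivity of an `A`-`B`-`⊗̂`-bimodule `P` in the relative category
`(A, R)-mod-(B, S)` of `A`-`B`-`⊗̂`-bimodules, whose exact structure consists of the sequences that
are split by continuous morphisms of `R`-`S`-bimodules: every morphism `f : P → Z` lifts through
every morphism `π : Y → Z` which has a right inverse `σ` that is a continuous morphism of
`R`-`S`-bimodules. -/
def IsRelProjective.{v} {R S A B P : Type*} [Ring R] [Algebra ℂ R] [Ring S] [Algebra ℂ S]
    [Ring A] [Algebra ℂ A] [UniformSpace A] [Ring B] [Algebra ℂ B] [UniformSpace B]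
    (η : R →ₐ[ℂ] A) (θ : S →ₐ[ℂ] B)
    [AddCommGroup P] [Module ℂ P] [UniformSpace P] [Module A P] [Module Bᵐᵒᵖ P] : Prop :=
  ∀ (Y Z : Type v)
    [AddCommGroup Y] [Module ℂ Y] [UniformSpace Y] [Module A Y] [Module Bᵐᵒᵖ Y]
    [AddCommGroup Z] [Module ℂ Z] [UniformSpace Z] [Module A Z] [Module Bᵐᵒᵖ Z],
    IsHatBimodule A B Y → IsHatBimodule A B Z →
    ∀ (π : Y →L[ℂ] Z) (σ : Z →L[ℂ] Y) (f : P →L[ℂ] Z),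
      IsBimoduleMap (AlgHom.id ℂ A) (AlgHom.id ℂ B) π →
      IsBimoduleMap η θ σ → (∀ z, π (σ z) = z) →
      IsBimoduleMap (AlgHom.id ℂ A) (AlgHom.id ℂ B) f →
      ∃ g : P →L[ℂ] Y, IsBimoduleMap (AlgHom.id ℂ A) (AlgHom.id ℂ B) g ∧ ∀ x, π (g x) = f x

/-- The pair `(A, η)` is an `R`-`⊗̂`-algebra: `R` and `A` are `⊗̂`-algebras and `η : R → A` is a
continuous unital homomorphism. -/
structure IsHatAlgebraOver {R A : Type*} [Ring R] [Algebra ℂ R] [UniformSpace R]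
    [Ring A] [Algebra ℂ A] [UniformSpace A] (η : R →ₐ[ℂ] A) : Prop where
  base : IsHatAlgebra R
  algebra : IsHatAlgebra A
  continuous : Continuous η

/-- The `R`-`⊗̂`-algebra `(A, η)` is relatively homologically trivial: `A` is projective in
`(A, R)-mod-(A, R)`. The universe `v` is that of the test bimodules. -/
structure IsRelHomTrivial.{v} {R A : Type*} [Ring R] [Algebra ℂ R] [UniformSpace R]
    [Ring A] [Algebra ℂ A] [UniformSpace A] (η : R →ₐ[ℂ] A) : Prop
    extends IsHatAlgebraOver η where
  projective : IsRelProjective.{v} (P := A) η η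

/-! ### Linearly complex reductive groups and semidirect products -/

/-- `η : K → L` is a universal complexification of the real Lie group `K`: it is a morphism of real
Lie groups into the complex Lie group `L`, and every morphism `α` of real Lie groups from `K` to a
complex Lie group `H` is `γ ∘ η` for a unique holomorphic homomorphism `γ : L → H`. -/
structure IsUniversalComplexification.{u, v}
    {EK : Type v} [NormedAddCommGroup EK] [NormedSpace ℝ EK]
    {K : Type u} [TopologicalSpace K] [ChartedSpace EK K] [Group K]
    {EL : Type v} [NormedAddCommGroup EL] [NormedSpace ℂ EL]
    {L : Type u} [TopologicalSpace L] [ChartedSpace EL L] [Group L]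
    (η : K →* L) : Prop where
  smooth : ContMDiff 𝓘(ℝ, EK) 𝓘(ℝ, EL) ∞ η
  existsUnique_extension : ∀ (EH : Type v) [NormedAddCommGroup EH] [NormedSpace ℂ EH]
    [FiniteDimensional ℂ EH] (H : Type u) [TopologicalSpace H] [ChartedSpace EH H] [Group H]
    [LieGroup 𝓘(ℂ, EH) ω H] [T2Space H] [SecondCountableTopology H] (α : K →* H),
    ContMDiff 𝓘(ℝ, EK) 𝓘(ℝ, EH) ∞ α →
      ∃! γ : L →* H, MDifferentiable 𝓘(ℂ, EL) 𝓘(ℂ, EH) γ ∧ γ.comp η = α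

/-- A complex Lie group `L` (modelled on `EL`) is linearly complex reductive if it is the universal
complexification of some compact real Lie group. -/
def IsLinearlyComplexReductive.{u, v}
    (EL : Type v) [NormedAddCommGroup EL] [NormedSpace ℂ EL]
    (L : Type u) [TopologicalSpace L] [ChartedSpace EL L] [Group L] : Prop :=
  ∃ (EK : Type v) (_ : NormedAddCommGroup EK) (_ : NormedSpace ℝ EK) (_ : FiniteDimensional ℝ EK)
    (K : Type u) (_ : TopologicalSpace K) (_ : ChartedSpace EK K) (_ : Group K)
    (_ : LieGroup 𝓘(ℝ, EK) ∞ K) (_ : CompactSpace K) (_ : T2Space K) (η : K →* L),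
    IsUniversalComplexification (EK := EK) (EL := EL) η

/-- The isomorphism of groups `e : N ⋊[φ] L ≃* G` exhibits the complex Lie group `G` as a semidirect
product of the complex Lie groups `N` and `L`: the bijection `(n, l) ↦ e (n, l)` from `N × L` onto
`G` is biholomorphic. -/
structure IsHolSemidirectProduct
    (EN EL EG : Type*) [NormedAddCommGroup EN] [NormedSpace ℂ EN]
    [NormedAddCommGroup EL] [NormedSpace ℂ EL] [NormedAddCommGroup EG] [NormedSpace ℂ EG]
    {N L G : Type*} [TopologicalSpace N] [ChartedSpace EN N] [Group N]
    [TopologicalSpace L] [ChartedSpace EL L] [Group L]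
    [TopologicalSpace G] [ChartedSpace EG G] [Group G]
    {φ : L →* MulAut N} (e : N ⋊[φ] L ≃* G) : Prop where
  mdifferentiable : MDifferentiable (𝓘(ℂ, EN).prod 𝓘(ℂ, EL)) 𝓘(ℂ, EG)
    fun p : N × L => e ⟨p.1, p.2⟩
  mdifferentiable_symm : MDifferentiable 𝓘(ℂ, EG) (𝓘(ℂ, EN).prod 𝓘(ℂ, EL))
    fun g : G => ((e.symm g).left, (e.symm g).right)

/-- The inclusion `N → N ⋊ L = G`, `n ↦ (n, 1)`, is holomorphic. -/
theorem IsHolSemidirectProduct.mdifferentiable_inl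
    {EN EL EG : Type*} [NormedAddCommGroup EN] [NormedSpace ℂ EN]
    [NormedAddCommGroup EL] [NormedSpace ℂ EL] [NormedAddCommGroup EG] [NormedSpace ℂ EG]
    {N L G : Type*} [TopologicalSpace N] [ChartedSpace EN N] [Group N]
    [TopologicalSpace L] [ChartedSpace EL L] [Group L]
    [TopologicalSpace G] [ChartedSpace EG G] [Group G]
    {φ : L →* MulAut N} {e : N ⋊[φ] L ≃* G} (he : IsHolSemidirectProduct EN EL EG e) :
    MDifferentiable 𝓘(ℂ, EN) 𝓘(ℂ, EG) (e.toMonoidHom.comp SemidirectProduct.inl) :=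
  he.mdifferentiable.comp (mdifferentiable_id.prodMk mdifferentiable_const)


universe v

/-!
A morphism `A → Z` of bimodules over `A = 𝒜(G)` is determined by the image `z` of `1`, an element
commuting with `A`; to lift it through `π : Y → Z` one needs `y : Y` commuting with `A` such that
`π y = z`. The section `σ` supplies `s = σ z`, which lies over `z` but commutes only with `𝒜(N)`. Let
`K` be the compact group whose universal complexification is `L`, and let `y` be the average over `K`
of the conjugates `δ_k s δ_k⁻¹` (`IsHatBimodule.exists_average`). Then `π y = z`, and `y` commutes
with `K` by invariance of Haar measure and still commutes with `N`, because `N` is normal.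

To pass from `K` to `L`, observe that for a continuous functional `l` on `Y` the function
`g ↦ l (δ_g y δ_g⁻¹)` on `L` is holomorphic and right invariant under `K`. Such a function `F` is
constant (`IsUniversalComplexification.eq_of_right_invariant`). Indeed its group of right periods
`C` is a complex Lie subgroup of `L`: at a point where the differentials of the translates `F (g * ·)`
have maximal rank, their common level set is a submanifold (`exists_slice_chart`), and this level set
is a left translate of an open piece of `C`. As `K → L` takes values in `C`, the universal property
provides a homomorphism `L → C` whose composition with the inclusion is the identity, so `C = L`.
Charts of `C` have to be analytic, which rests on the analyticity of complex differentiable functions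
of several variables (`DifferentiableOn.contDiffOn_of_finiteDimensional`).

Thus `y` commutes with all `δ_g`, `g ∈ G = N L`, and hence with `𝒜(G)`, as the point evaluations span
a dense subspace (`AnFun.eq_zero_of_apply_delta`). The topological input about `𝒜(G)` comes from
Cauchy estimates, which make bounded families of holomorphic functions locally equi-Lipschitz, and
from the metrizability of `𝒪(G)`, which makes `𝒜(G)` complete and convolution jointly continuous
(`AnFun.continuous_mul`).
-/

/-! ### Holomorphic functions of several variables are analytic -/

section SeveralVariables
open Set Metric MeasureTheory

theorem norm_torusMap_zero_apply {n : ℕ} {R : ℝ} (hR : 0 ≤ R) (θ : Fin n → ℝ) (i : Fin n) :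
    ‖torusMap 0 (fun _ => R) θ i‖ = R := by
  simp [torusMap, Complex.norm_exp_ofReal_mul_I, abs_of_nonneg hR]

theorem torusMap_zero_mem_ball {n : ℕ} {R R' : ℝ} (hR : 0 < R) (hRR' : R < R') (θ : Fin n → ℝ) :
    torusMap 0 (fun _ => R) θ ∈ ball (0 : Fin n → ℂ) R' := by
  rw [mem_ball_zero_iff]
  exact (pi_norm_lt_iff (hR.trans hRR')).2 fun i => by rwa [norm_torusMap_zero_apply hR.le]

theorem torusMap_sub_ne_zero {n : ℕ} {R : ℝ} {z : Fin n → ℂ} (hz : z ∈ ball (0 : Fin n → ℂ) R)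
    (θ : Fin n → ℝ) (i : Fin n) : torusMap 0 (fun _ => R) θ i - z i ≠ 0 := by
  rw [mem_ball_zero_iff] at hz
  have hR : 0 < R := (norm_nonneg _).trans_lt hz
  intro h
  have h1 := norm_torusMap_zero_apply hR.le θ i
  rw [sub_eq_zero.1 h] at h1
  exact (((pi_norm_lt_iff hR).1 hz i).trans_eq h1.symm).false

theorem continuous_torusMap {n : ℕ} (c : Fin n → ℂ) (R : Fin n → ℝ) :
    Continuous (torusMap c R) := by
  unfold torusMap; fun_prop

theorem continuous_torusMap_apply {n : ℕ} (c : Fin n → ℂ) (R : Fin n → ℝ) (i : Fin n) :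
    Continuous fun θ => torusMap c R θ i :=
  (continuous_apply i).comp (continuous_torusMap c R)

/-- Cauchy's integral formula on a polydisc. -/
theorem torusIntegral_cauchy {R R' : ℝ} (hR : 0 < R) (hRR' : R < R') :
    ∀ {n : ℕ} {f : (Fin n → ℂ) → ℂ}, DifferentiableOn ℂ f (ball 0 R') →
      ∀ {z : Fin n → ℂ}, z ∈ ball (0 : Fin n → ℂ) R →
      (∯ ζ in T(0, fun _ => R), (∏ i, (ζ i - z i)⁻¹) * f ζ)
        = (2 * Real.pi * Complex.I) ^ n * f z := by
  intro n
  induction n with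
  | zero =>
    intro f _ z _
    rw [torusIntegral_dim0]
    simp [Subsingleton.elim z 0]
  | succ n ih =>
    intro f hf z hz
    have hint : TorusIntegrable (fun ζ : Fin (n + 1) → ℂ => (∏ i, (ζ i - z i)⁻¹) * f ζ) 0
        (fun _ => R) := by
      have h1 : Continuous fun θ => f (torusMap 0 (fun _ => R) θ) :=
        hf.continuousOn.comp_continuous (continuous_torusMap _ _)
          fun θ => torusMap_zero_mem_ball hR hRR' θ
      have h2 : Continuous fun θ => ∏ i, (torusMap 0 (fun _ => R) θ i - z i)⁻¹ :=
        continuous_finsetProd _ fun i _ =>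
          ((continuous_torusMap_apply _ _ i).sub continuous_const).inv₀
            fun θ => torusMap_sub_ne_zero hz θ i
      exact (h2.mul h1).continuousOn.integrableOn_compact isCompact_Icc
    rw [torusIntegral_succ hint]
    have hz' := (pi_norm_lt_iff hR).1 (mem_ball_zero_iff.1 hz)
    have hcons : ∀ x : ℂ, ‖x‖ < R' → ∀ y ∈ ball (0 : Fin n → ℂ) R',
        (Fin.cons x y : Fin (n + 1) → ℂ) ∈ ball (0 : Fin (n + 1) → ℂ) R' := by
      intro x hx y hy
      rw [mem_ball_zero_iff] at hy ⊢
      refine (pi_norm_lt_iff (hR.trans hRR')).2 fun i => ?_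
      refine Fin.cases ?_ (fun j => ?_) i
      · simpa using hx
      · simpa using (pi_norm_lt_iff (hR.trans hRR')).1 hy j
    have hzt : Fin.tail z ∈ ball (0 : Fin n → ℂ) R := by
      rw [mem_ball_zero_iff]
      exact (pi_norm_lt_iff hR).2 fun i => hz' i.succ
    have hzt' : Fin.tail z ∈ ball (0 : Fin n → ℂ) R' := ball_subset_ball hRR'.le hzt
    have hinner : ∀ x ∈ sphere (0 : ℂ) R,
        (∯ y in T((0 : Fin (n + 1) → ℂ) ∘ Fin.succ, (fun _ : Fin (n + 1) => R) ∘ Fin.succ),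
          (∏ i, ((Fin.cons x y : Fin (n + 1) → ℂ) i - z i)⁻¹) * f (Fin.cons x y))
        = (x - z 0)⁻¹ • ((2 * Real.pi * Complex.I) ^ n * f (Fin.cons x (Fin.tail z))) := by
      intro x hx
      have hxR : ‖x‖ < R' := by rw [mem_sphere_zero_iff_norm] at hx; rwa [hx]
      have hd : DifferentiableOn ℂ (fun y : Fin n → ℂ => f (Fin.cons x y)) (ball 0 R') := by
        refine hf.comp (t := ball 0 R') ?_ fun y hy => hcons x hxR y hy
        refine Differentiable.differentiableOn (differentiable_pi.2 fun i => ?_)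
        refine Fin.cases ?_ (fun j => ?_) i
        · simp
        · simpa using differentiable_apply j
      rw [← ih hd hzt, smul_eq_mul, ← smul_eq_mul, ← torusIntegral_smul]
      congr 1
      ext y
      rw [Fin.prod_univ_succ]
      simp [Fin.tail, mul_assoc]
    rw [show (0 : Fin (n + 1) → ℂ) 0 = 0 from rfl, circleIntegral.integral_congr hR.le hinner]
    have hd2 : DifferentiableOn ℂ (fun x : ℂ => (2 * Real.pi * Complex.I) ^ n *
        f (Fin.cons x (Fin.tail z))) (ball 0 R') := by
      refine DifferentiableOn.const_mul ?_ _
      refine hf.comp (t := ball 0 R') ?_ fun x hx => hcons x (mem_ball_zero_iff.1 hx) _ hzt'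
      refine Differentiable.differentiableOn (differentiable_pi.2 fun i => ?_)
      refine Fin.cases ?_ (fun j => ?_) i
      · simp
      · simp
    have := Complex.circleIntegral_sub_inv_smul_of_differentiable_on_off_countable
      (c := (0 : ℂ)) (R := R) (w := z 0) Set.countable_empty (by simpa using hz' 0)
      (hd2.continuousOn.mono (closedBall_subset_ball hRR'))
      (fun x hx => hd2.differentiableAt (isOpen_ball.mem_nhds (ball_subset_ball hRR'.le hx.1)))
    rw [this, Fin.cons_self_tail, smul_eq_mul]
    ring

theorem ContinuousMap.exists_clm_integral_mul {X : Type*} [TopologicalSpace X] [CompactSpace X]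
    [MeasurableSpace X] [BorelSpace X] (μ : Measure X) [IsFiniteMeasure μ] (W : C(X, ℂ)) :
    ∃ Λ : C(X, ℂ) →L[ℂ] ℂ, ∀ h, Λ h = ∫ θ, W θ * h θ ∂μ := by
  have hi : ∀ h : C(X, ℂ), Integrable (fun θ => W θ * h θ) μ := fun h =>
    ((W * h).continuous.integrable_of_hasCompactSupport (HasCompactSupport.of_compactSpace _))
  refine ⟨LinearMap.mkContinuous
    { toFun := fun h => ∫ θ, W θ * h θ ∂μ
      map_add' := fun g h => by
        simp only [ContinuousMap.add_apply, mul_add]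
        exact integral_add (hi g) (hi h)
      map_smul' := fun c h => by
        rw [RingHom.id_apply, smul_eq_mul, ← integral_const_mul]
        refine integral_congr_ae (Filter.Eventually.of_forall fun θ => ?_)
        exact mul_left_comm (W θ) c (h θ) }
    (‖W‖ * μ.real univ) fun h => ?_, fun h => rfl⟩
  have := norm_integral_le_of_norm_le_const (μ := μ) (f := fun θ => W θ * h θ)
    (C := ‖W‖ * ‖h‖) (Filter.Eventually.of_forall fun θ => (norm_mul_le _ _).trans
      (mul_le_mul (W.norm_coe_le_norm θ) (h.norm_coe_le_norm θ) (norm_nonneg _) (norm_nonneg _)))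
  exact this.trans (le_of_eq (by ring))

/-- Cauchy's formula presents `f` near `0` as a continuous linear functional applied to the Cauchy
kernel, which depends analytically on the point as an element of the Banach algebra of continuous
functions on the torus. -/
theorem DifferentiableOn.analyticAt_zero_pi {n : ℕ} {f : (Fin n → ℂ) → ℂ} {r : ℝ} (hr : 0 < r)
    (hf : DifferentiableOn ℂ f (ball 0 r)) : AnalyticAt ℂ f 0 := by
  obtain ⟨R, hR, hRr⟩ := exists_between hr
  have : CompactSpace (Icc (0 : Fin n → ℝ) fun _ => 2 * Real.pi) := isCompact_iff_compactSpace.1 isCompact_Icc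
  let μ : Measure (Icc (0 : Fin n → ℝ) fun _ => 2 * Real.pi) := Measure.comap (Subtype.val : (Icc (0 : Fin n → ℝ) fun _ => 2 * Real.pi) → Fin n → ℝ) volume
  have hμ : IsFiniteMeasure μ := by
    refine ⟨?_⟩
    rw [Measure.comap_apply _ Subtype.val_injective (fun s hs =>
      measurableSet_Icc.subtype_image hs) _ MeasurableSet.univ]
    rw [image_univ, Subtype.range_coe]
    exact isCompact_Icc.measure_lt_top
  let W : C((Icc (0 : Fin n → ℝ) fun _ => 2 * Real.pi), ℂ) := ⟨fun θ => (∏ i, (R : ℂ) * Complex.exp (θ.1 i * Complex.I) * Complex.I) *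
    f (torusMap 0 (fun _ => R) θ.1), by
      refine Continuous.mul (continuous_finsetProd _ fun i _ => ?_) ?_
      · have : Continuous fun θ : (Icc (0 : Fin n → ℝ) fun _ => 2 * Real.pi) => θ.1 i := (continuous_apply i).comp continuous_subtype_val
        exact (continuous_const.mul (Complex.continuous_exp.comp
          ((Complex.continuous_ofReal.comp this).mul continuous_const))).mul continuous_const
      exact hf.continuousOn.comp_continuous ((continuous_torusMap _ _).comp continuous_subtype_val)
          fun θ => torusMap_zero_mem_ball hR hRr θ.1⟩
  obtain ⟨Λ, hΛ⟩ := ContinuousMap.exists_clm_integral_mul μ W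
  let ζ : Fin n → C((Icc (0 : Fin n → ℝ) fun _ => 2 * Real.pi), ℂ) := fun i => ⟨fun θ => torusMap 0 (fun _ => R) θ.1 i,
    (continuous_torusMap_apply 0 (fun _ => R) i).comp continuous_subtype_val⟩
  let k : (Fin n → ℂ) → C((Icc (0 : Fin n → ℝ) fun _ => 2 * Real.pi), ℂ) := fun z => ∏ i, (ζ i - algebraMap ℂ C((Icc (0 : Fin n → ℝ) fun _ => 2 * Real.pi), ℂ) (z i))
  have hk : ∀ z θ, k z θ = ∏ i, (torusMap 0 (fun _ => R) θ.1 i - z i) := by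
    intro z θ
    simp only [k, ContinuousMap.prod_apply]
    rfl
  have hunit : ∀ z ∈ ball (0 : Fin n → ℂ) R, IsUnit (k z) := by
    intro z hz
    rw [ContinuousMap.isUnit_iff_forall_ne_zero]
    intro θ
    rw [hk]
    exact Finset.prod_ne_zero_iff.2 fun i _ => torusMap_sub_ne_zero hz θ.1 i
  have hinv : ∀ z ∈ ball (0 : Fin n → ℂ) R, ∀ θ, Ring.inverse (k z) θ = (k z θ)⁻¹ := by
    intro z hz θ
    refine eq_inv_of_mul_eq_one_left ?_
    rw [← ContinuousMap.mul_apply, Ring.inverse_mul_cancel _ (hunit z hz)]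
    rfl
  have hkan : AnalyticAt ℂ k 0 := by
    refine Finset.analyticAt_fun_prod _ fun i _ => ?_
    refine analyticAt_const.sub ?_
    exact ((Algebra.linearMap ℂ C((Icc (0 : Fin n → ℝ) fun _ => 2 * Real.pi), ℂ)).toContinuousLinearMap.comp
      (ContinuousLinearMap.proj i : (Fin n → ℂ) →L[ℂ] ℂ)).analyticAt 0
  have hIk : AnalyticAt ℂ (fun z => Ring.inverse (k z)) 0 := by
    have h0 := hunit 0 (mem_ball_self hR)
    have := analyticAt_inverse (𝕜 := ℂ) h0.unit
    exact AnalyticAt.fun_comp (f := k) this hkan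
  have hmain : AnalyticAt ℂ (fun z => ((2 * Real.pi * Complex.I) ^ n)⁻¹ * Λ (Ring.inverse (k z))) 0 :=
    analyticAt_const.mul ((Λ.analyticAt _).fun_comp hIk)
  refine hmain.congr ?_
  filter_upwards [ball_mem_nhds 0 hR] with z hz
  have hΛ' : Λ (Ring.inverse (k z)) = ∯ ζ in T(0, fun _ => R), (∏ i, (ζ i - z i)⁻¹) * f ζ := by
    rw [torusIntegral, ← integral_subtype_comap measurableSet_Icc, hΛ]
    refine integral_congr_ae (Filter.Eventually.of_forall fun θ => ?_)
    simp only [hinv z hz, hk, W, ContinuousMap.coe_mk, smul_eq_mul, Finset.prod_inv_distrib]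
    ring
  rw [hΛ', torusIntegral_cauchy hR hRr hf hz]
  exact inv_mul_cancel_left₀ (pow_ne_zero _ Complex.two_pi_I_ne_zero) _

/-- A complex differentiable function on an open subset of a finite-dimensional space is
analytic. -/
theorem DifferentiableOn.contDiffOn_of_finiteDimensional {E : Type*} [NormedAddCommGroup E]
    [NormedSpace ℂ E] [FiniteDimensional ℂ E] {f : E → ℂ} {U : Set E} (hU : IsOpen U)
    (hf : DifferentiableOn ℂ f U) : ContDiffOn ℂ ω f U := by
  intro x hx
  refine ContDiffAt.contDiffWithinAt ?_
  let e : (Fin (Module.finrank ℂ E) → ℂ) ≃L[ℂ] E := ContinuousLinearEquiv.ofFinrankEq (by simp)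
  have hO : IsOpen ((fun z => x + e z) ⁻¹' U) := hU.preimage (by fun_prop)
  obtain ⟨r, hr, hrU⟩ := Metric.isOpen_iff.1 hO 0 (by simpa using hx)
  have hd : DifferentiableOn ℂ (fun z => f (x + e z)) (ball 0 r) :=
    hf.comp (by fun_prop) hrU
  have h1 := hd.analyticAt_zero_pi hr
  have h2 : AnalyticAt ℂ (fun y => e.symm (y - x)) x :=
    (e.symm.toContinuousLinearMap.analyticAt _).fun_comp (analyticAt_id.sub analyticAt_const)
  have h3 : AnalyticAt ℂ (fun y => f (x + e (e.symm (y - x)))) x := by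
    refine AnalyticAt.fun_comp (g := fun z => f (x + e z)) (f := fun y => e.symm (y - x)) ?_ h2
    simpa using h1
  simpa using h3.contDiffAt

end SeveralVariables

/-! ### Common level sets of families of holomorphic functions -/

section LevelSets
open Set Metric

/-- At a point where a family of functions has maximal rank `r`, its differentials have the same
kernel as the differentials of `r` suitable members of the family. -/
theorem exists_maximal_submersion {E ι : Type*} [NormedAddCommGroup E] [NormedSpace ℂ E]
    [FiniteDimensional ℂ E] {U : Set E} (hne : U.Nonempty) (A : ι → E → E →L[ℂ] ℂ) :
    ∃ (r : ℕ) (l : Fin r → ι), (∃ x ∈ U, Function.Surjective fun v => fun j => A (l j) x v) ∧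
      ∀ x ∈ U, (Function.Surjective fun v => fun j => A (l j) x v) →
        ∀ v, (∀ j, A (l j) x v = 0) → ∀ i, A i x v = 0 := by
  classical
  let P : ℕ → Prop := fun r => ∃ (l : Fin r → ι), ∃ x ∈ U,
    Function.Surjective fun v => fun j => A (l j) x v
  have hP0 : P 0 := by
    obtain ⟨x, hx⟩ := hne
    exact ⟨Fin.elim0, x, hx, fun a => ⟨0, Subsingleton.elim _ _⟩⟩
  have hbd : ∀ r, P r → r ≤ Module.finrank ℂ E := by
    rintro r ⟨l, x, -, hs⟩
    have := LinearMap.finrank_le_finrank_of_surjective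
      (f := LinearMap.pi fun j => (A (l j) x).toLinearMap) hs
    simpa using this
  obtain ⟨l, hx⟩ : P (Nat.findGreatest P (Module.finrank ℂ E)) :=
    Nat.findGreatest_spec (Nat.zero_le _) hP0
  refine ⟨_, l, hx, fun x hx hs v hv i => ?_⟩
  by_contra hi
  have hP : P (Nat.findGreatest P (Module.finrank ℂ E) + 1) := by
    refine ⟨Fin.cons i l, x, hx, fun a => ?_⟩
    obtain ⟨u, hu⟩ := hs (Fin.tail a)
    refine ⟨u + ((a 0 - A i x u) / A i x v) • v, funext fun j => ?_⟩
    refine Fin.cases ?_ (fun k => ?_) j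
    · simp [div_mul_cancel₀ _ hi]
    · simpa [hv k, Fin.tail] using congrFun hu k
  exact Nat.not_succ_le_self _ (Nat.le_findGreatest (hbd _ hP) hP)

/-- Near a point of maximal rank, a common level set of a family of holomorphic functions is a
complex submanifold: there is a biholomorphic chart in which it is a coordinate slice. -/
theorem exists_slice_chart {E ι : Type*} [NormedAddCommGroup E] [NormedSpace ℂ E]
    [FiniteDimensional ℂ E] {U : Set E} (hU : IsOpen U) (hne : U.Nonempty) (f : ι → E → ℂ)
    (hf : ∀ i, DifferentiableOn ℂ (f i) U) :
    ∃ (r : ℕ) (W : Submodule ℂ E) (T : OpenPartialHomeomorph E ((Fin r → ℂ) × W)) (x₀ : E),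
      x₀ ∈ T.source ∧ T.source ⊆ U ∧ ContDiffOn ℂ ω T T.source ∧
      ContDiffOn ℂ ω T.symm T.target ∧
      ∀ x ∈ T.source, (∀ i, f i x = f i x₀) ↔ (T x).1 = 0 := by
  obtain ⟨r, l, ⟨x₀, hx₀, hsurj⟩, hker⟩ :=
    exists_maximal_submersion hne fun i x => fderiv ℂ (f i) x
  have hfc : ∀ i, ContDiffOn ℂ ω (f i) U := fun i => (hf i).contDiffOn_of_finiteDimensional hU
  have hfd : ∀ i, ∀ x ∈ U, HasFDerivAt (f i) (fderiv ℂ (f i) x) x := fun i x hx =>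
    ((hf i).differentiableAt (hU.mem_nhds hx)).hasFDerivAt
  let A : E → E →L[ℂ] (Fin r → ℂ) := fun x => ContinuousLinearMap.pi fun j => fderiv ℂ (f (l j)) x
  have hA : ∀ x v j, A x v j = fderiv ℂ (f (l j)) x v := fun x v j => rfl
  let W : Submodule ℂ E := (A x₀).toLinearMap.ker
  obtain ⟨p₀, hp₀⟩ := W.subtype.exists_leftInverse_of_injective W.ker_subtype
  let p : E →L[ℂ] W := p₀.toContinuousLinearMap
  have hp : ∀ w : W, p w = w := fun w => LinearMap.congr_fun hp₀ w
  let g : E → (Fin r → ℂ) × W := fun x => (fun j => f (l j) x - f (l j) x₀, p (x - x₀))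
  let g' : E → E →L[ℂ] (Fin r → ℂ) × W := fun x => (A x).prod p
  have hgd : ∀ x ∈ U, HasFDerivAt g (g' x) x := fun x hx => by
    refine HasFDerivAt.prodMk (hasFDerivAt_pi.2 fun j => (hfd (l j) x hx).sub_const _) ?_
    exact p.hasFDerivAt.comp x ((hasFDerivAt_id x).sub_const x₀)
  have hgc : ContDiffOn ℂ ω g U := by
    refine ContDiffOn.prodMk (contDiffOn_pi.2 fun j => (hfc (l j)).sub contDiffOn_const) ?_
    exact (p.contDiff.comp (contDiff_id.sub contDiff_const)).contDiffOn
  have hg0 : g x₀ = 0 := by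
    apply Prod.ext
    · funext j; simp [g]
    · simp [g]
  obtain ⟨e, he⟩ : ∃ e : E ≃L[ℂ] (Fin r → ℂ) × W, (e : E →L[ℂ] _) = g' x₀ := by
    refine ⟨ContinuousLinearEquiv.ofBijective (g' x₀) ?_ ?_, by ext <;> rfl⟩
    · rw [LinearMap.ker_eq_bot']
      intro v hv
      have h1 : A x₀ v = 0 := congrArg Prod.fst hv
      have h2 : p v = 0 := congrArg Prod.snd hv
      have h3 := hp ⟨v, h1⟩
      rw [h2] at h3
      exact congrArg Subtype.val h3.symm
    · rw [LinearMap.range_eq_top]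
      rintro ⟨a, w⟩
      obtain ⟨u, hu⟩ := hsurj a
      have hu : A x₀ u = a := hu
      refine ⟨u + w - p u, Prod.ext ?_ ?_⟩
      · change A x₀ (u + w - p u) = a
        have h1 : A x₀ w = 0 := w.2
        have h2 : A x₀ (p u) = 0 := (p u).2
        rw [map_sub, map_add, h1, h2, hu, add_zero, sub_zero]
      · change p (u + w - p u) = w
        rw [map_sub, map_add, hp, hp]
        abel
  have hgx₀ : ContDiffAt ℂ ω g x₀ := hgc.contDiffAt (hU.mem_nhds hx₀)
  have hge : HasFDerivAt g (e : E →L[ℂ] _) x₀ := he ▸ hgd x₀ hx₀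
  let T₀ := hgx₀.toOpenPartialHomeomorph g hge (by simp)
  have hT₀ : ⇑T₀ = g := rfl
  -- the set where the differential of `g` stays invertible
  have hO : IsOpen {x ∈ U | ∃ e' : E ≃L[ℂ] (Fin r → ℂ) × W, (e' : E →L[ℂ] _) = g' x} := by
    have hc : ContinuousOn g' U := by
      refine (hgc.continuousOn_fderiv_of_isOpen hU (by simp)).congr fun x hx => ?_
      exact (hgd x hx).fderiv.symm
    exact hc.isOpen_inter_preimage hU (ContinuousLinearEquiv.isOpen (𝕜 := ℂ))
  let T₁ := T₀.restrOpen _ hO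
  have hT₁s : x₀ ∈ T₁.source :=
    ⟨hgx₀.mem_toOpenPartialHomeomorph_source hge (by simp), hx₀, e, he⟩
  have hT₁t : (0 : (Fin r → ℂ) × W) ∈ T₁.target := by
    have := T₁.map_source hT₁s
    rwa [show T₁ x₀ = 0 from hg0] at this
  obtain ⟨ε, hε, hball⟩ := Metric.isOpen_iff.1 T₁.open_target 0 hT₁t
  let T := (T₁.symm.restrOpen (ball 0 ε) isOpen_ball).symm
  have hTs : T.source = T₁.source ∩ T₁ ⁻¹' ball 0 ε := rfl
  have hTt : T.target = ball 0 ε := by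
    change T₁.target ∩ ball 0 ε = _
    exact inter_eq_right.2 hball
  have hTg : ⇑T = g := rfl
  have hsU : T.source ⊆ U := fun x hx => hx.1.2.1
  have hinv : ∀ x ∈ T.source, ∃ e' : E ≃L[ℂ] (Fin r → ℂ) × W, (e' : E →L[ℂ] _) = g' x :=
    fun x hx => hx.1.2.2
  have hsymm : ∀ y ∈ T.target, ContDiffAt ℂ ω T.symm y := by
    intro y hy
    have hx := T.map_target hy
    obtain ⟨e', he'⟩ := hinv _ hx
    refine T.contDiffAt_symm (f₀' := e') hy ?_ ?_
    · rw [he']; exact hgd _ (hsU hx)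
    · exact hgc.contDiffAt (hU.mem_nhds (hsU hx))
  refine ⟨r, W, T, x₀, ⟨hT₁s, ?_⟩, hsU, hgc.mono hsU,
    fun y hy => (hsymm y hy).contDiffWithinAt, fun x hx => ⟨fun h => ?_, fun h i => ?_⟩⟩
  · change g x₀ ∈ ball 0 ε
    rw [hg0]; exact mem_ball_self hε
  · change (fun j => f (l j) x - f (l j) x₀) = 0
    funext j
    simp [h (l j)]
  -- along the slice every member of the family has zero derivative
  · have hmem : ∀ w ∈ ball (0 : W) ε, ((0, w) : (Fin r → ℂ) × W) ∈ T.target := by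
      intro w hw
      rw [hTt, mem_ball_zero_iff, Prod.norm_mk, norm_zero]
      exact max_lt hε (mem_ball_zero_iff.1 hw)
    have hd : ∀ w ∈ ball (0 : W) ε, HasFDerivAt (fun w : W => f i (T.symm (0, w))) (0 : W →L[ℂ] ℂ) w := by
      intro w hw
      have hy := hmem w hw
      have hxs := T.map_target hy
      have hxU := hsU hxs
      have h1 : HasFDerivAt T.symm (fderiv ℂ T.symm (0, w)) (0, w) :=
        ((hsymm _ hy).differentiableAt (by simp)).hasFDerivAt
      have h2 : HasFDerivAt (fun w : W => T.symm (0, w))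
          ((fderiv ℂ T.symm (0, w)).comp (ContinuousLinearMap.inr ℂ (Fin r → ℂ) W)) w :=
        h1.comp w (hasFDerivAt_prodMk_right 0 w)
      have h3 := (hfd i _ hxU).comp w h2
      refine h3.congr_fderiv ?_
      ext v
      obtain ⟨e', he'⟩ := hinv _ hxs
      refine hker _ hxU ?_ _ (fun j => ?_) i
      · intro a
        refine ⟨e'.symm (a, 0), ?_⟩
        have : g' (T.symm (0, w)) (e'.symm (a, 0)) = (a, 0) := by
          rw [← he']; exact e'.apply_symm_apply _
        exact congrArg Prod.fst this
      · have h4 := ((hgd _ hxU).comp w h2)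
        have h5 : HasFDerivAt (g ∘ fun w : W => T.symm (0, w))
            (ContinuousLinearMap.inr ℂ (Fin r → ℂ) W) w := by
          refine (hasFDerivAt_prodMk_right 0 w).congr_of_eventuallyEq ?_
          filter_upwards [isOpen_ball.mem_nhds hw] with w' hw'
          exact T.right_inv (hmem w' hw')
        have h6 := DFunLike.congr_fun (h4.unique h5) v
        exact congrFun (congrArg Prod.fst h6) j
    let w : W := (T x).2
    have hTx : T x = (0, w) := Prod.ext h rfl
    have hw : w ∈ ball (0 : W) ε := by
      have := T.map_source hx
      rw [hTt, hTx, mem_ball_zero_iff, Prod.norm_mk] at this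
      exact mem_ball_zero_iff.2 ((le_max_right _ _).trans_lt this)
    have hconst := isOpen_ball.is_const_of_fderiv_eq_zero (𝕜 := ℂ)
      (convex_ball (0 : W) ε).isPreconnected
      (fun w hw => (hd w hw).differentiableAt.differentiableWithinAt)
      (fun w hw => (hd w hw).fderiv) hw (mem_ball_self hε)
    have hx₀s : x₀ ∈ T.source := ⟨hT₁s, by
      change g x₀ ∈ ball 0 ε
      rw [hg0]; exact mem_ball_self hε⟩
    have e1 : T.symm (0, w) = x := by rw [← hTx]; exact T.left_inv hx
    have e2 : T.symm (0, 0) = x₀ := by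
      have := T.left_inv hx₀s
      rwa [show T x₀ = (0, 0) from hg0] at this
    simpa only [e1, e2] using hconst

end LevelSets

/-! ### Lie subgroups cut out by a slice chart -/

section LieSubgroup
open Set

theorem ContMDiffAt.restrictScalars_real {E E' M : Type*} [NormedAddCommGroup E] [NormedSpace ℂ E]
    [NormedAddCommGroup E'] [NormedSpace ℂ E'] [TopologicalSpace M] [ChartedSpace E M]
    {f : M → E'} {x : M} (hf : ContMDiffAt 𝓘(ℂ, E) 𝓘(ℂ, E') ω f x) :
    ContMDiffAt 𝓘(ℝ, E) 𝓘(ℝ, E') ∞ f x := by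
  rw [contMDiffAt_iff] at hf ⊢
  exact ⟨hf.1, (hf.2.restrict_scalars ℝ).of_le (by exact_mod_cast le_top)⟩

/-- A chart `T` of `L` is a slice chart for the subgroup `C` if `C` is the zero set of the first
component of `T`. -/
structure IsSliceChart {E V W L : Type*} [NormedAddCommGroup E] [NormedSpace ℂ E]
    [NormedAddCommGroup V] [NormedSpace ℂ V] [NormedAddCommGroup W] [NormedSpace ℂ W]
    [TopologicalSpace L] [ChartedSpace E L] [Group L] (C : Subgroup L)
    (T : OpenPartialHomeomorph L (V × W)) : Prop where
  one_mem : 1 ∈ T.source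
  contMDiffOn : ContMDiffOn 𝓘(ℂ, E) 𝓘(ℂ, V × W) ω T T.source
  contMDiffOn_symm : ContMDiffOn 𝓘(ℂ, V × W) 𝓘(ℂ, E) ω T.symm T.target
  mem_iff : ∀ g ∈ T.source, g ∈ C ↔ (T g).1 = 0

namespace IsSliceChart

variable {E V W L : Type*} [NormedAddCommGroup E] [NormedSpace ℂ E]
    [NormedAddCommGroup V] [NormedSpace ℂ V] [NormedAddCommGroup W] [NormedSpace ℂ W]
    [TopologicalSpace L] [ChartedSpace E L] [Group L] {C : Subgroup L}
    {T : OpenPartialHomeomorph L (V × W)}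

theorem symm_mem (hT : IsSliceChart (E := E) C T) {w : W} (hw : ((0, w) : V × W) ∈ T.target) :
    T.symm (0, w) ∈ C :=
  (hT.mem_iff _ (T.map_target hw)).2 (by rw [T.right_inv hw])

theorem apply_eq (hT : IsSliceChart (E := E) C T) {c : L} (hc : c ∈ T.source) (hcC : c ∈ C) :
    ((0, (T c).2) : V × W) = T c :=
  Prod.ext ((hT.mem_iff c hc).1 hcC).symm rfl

open Classical in
/-- The chart of `C` at the identity induced by a slice chart. -/
noncomputable def chartOne (hT : IsSliceChart (E := E) C T) : OpenPartialHomeomorph C W where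
  toFun c := (T c).2
  invFun w := if h : ((0, w) : V × W) ∈ T.target then ⟨T.symm (0, w), hT.symm_mem h⟩ else 1
  source := {c | (c : L) ∈ T.source}
  target := {w | ((0, w) : V × W) ∈ T.target}
  map_source' c hc := by
    change ((0, (T c).2) : V × W) ∈ T.target
    rw [hT.apply_eq hc c.2]
    exact T.map_source hc
  map_target' w hw := by
    have hw : ((0, w) : V × W) ∈ T.target := hw
    simp only [hw, dif_pos]
    exact T.map_target hw
  left_inv' c hc := by
    have h := hT.apply_eq hc c.2
    have hw : ((0, (T c).2) : V × W) ∈ T.target := by rw [h]; exact T.map_source hc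
    simp only [hw, dif_pos]
    apply Subtype.ext
    simp only [h]
    exact T.left_inv hc
  right_inv' w hw := by
    have hw : ((0, w) : V × W) ∈ T.target := hw
    simp only [hw, dif_pos]
    rw [T.right_inv hw]
  open_source := T.open_source.preimage continuous_subtype_val
  open_target := T.open_target.preimage (by fun_prop)
  continuousOn_toFun := continuous_snd.comp_continuousOn
    (T.continuousOn.comp continuous_subtype_val.continuousOn fun _ hc => hc)
  continuousOn_invFun := by
    rw [Topology.IsInducing.subtypeVal.continuousOn_iff]
    have : ContinuousOn (fun w : W => T.symm ((0, w) : V × W))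
        {w | ((0, w) : V × W) ∈ T.target} :=
      T.continuousOn_symm.comp (by fun_prop) fun _ hw => hw
    refine this.congr fun w hw => ?_
    have hw : ((0, w) : V × W) ∈ T.target := hw
    simp only [Function.comp_apply, hw, dif_pos]

theorem chartOne_symm_coe (hT : IsSliceChart (E := E) C T) {w : W} (hw : w ∈ hT.chartOne.target) :
    ((hT.chartOne.symm w : C) : L) = T.symm (0, w) := by
  have hw : ((0, w) : V × W) ∈ T.target := hw
  exact congrArg Subtype.val (dif_pos hw)

variable [LieGroup 𝓘(ℂ, E) ω L]

/-- The chart of `C` at `c`, a left translate of the chart at the identity. -/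
noncomputable def chart (hT : IsSliceChart (E := E) C T) (c : C) : OpenPartialHomeomorph C W :=
  have := topologicalGroup_of_lieGroup 𝓘(ℂ, E) ω (G := L)
  (Homeomorph.mulLeft c⁻¹).transOpenPartialHomeomorph hT.chartOne

theorem chart_source (hT : IsSliceChart (E := E) C T) (c : C) :
    (hT.chart c).source = {c' : C | (c : L)⁻¹ * (c' : L) ∈ T.source} := rfl

theorem mem_chart_source (hT : IsSliceChart (E := E) C T) (c : C) : c ∈ (hT.chart c).source := by
  rw [chart_source, mem_ofPred_eq, inv_mul_cancel]
  exact hT.one_mem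

theorem chart_symm_coe (hT : IsSliceChart (E := E) C T) (c : C) {w : W}
    (hw : w ∈ (hT.chart c).target) : (((hT.chart c).symm w : C) : L) = c * T.symm (0, w) := by
  have h1 : (hT.chart c).symm w = c⁻¹⁻¹ * hT.chartOne.symm w := rfl
  rw [h1, inv_inv, Subgroup.coe_mul, hT.chartOne_symm_coe hw]

/-- The structure of a complex manifold on `C` given by left translates of a slice chart. -/
@[reducible] noncomputable def chartedSpace (hT : IsSliceChart (E := E) C T) : ChartedSpace W C where
  atlas := range hT.chart
  chartAt := hT.chart
  mem_chart_source := hT.mem_chart_source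
  chart_mem_atlas := mem_range_self

theorem contMDiffOn_coord (hT : IsSliceChart (E := E) C T) (g : L) :
    ContMDiffOn 𝓘(ℂ, E) 𝓘(ℂ, W) ω (fun x => (T (g⁻¹ * x)).2) {x | g⁻¹ * x ∈ T.source} := by
  have h1 : ContMDiff 𝓘(ℂ, V × W) 𝓘(ℂ, W) ω (Prod.snd : V × W → W) := contDiff_snd.contMDiff
  exact h1.comp_contMDiffOn (hT.contMDiffOn.comp
    (contMDiff_mul_left (I := 𝓘(ℂ, E)) (n := ω)).contMDiffOn fun _ hx => hx)

theorem contMDiffOn_param (hT : IsSliceChart (E := E) C T) (g : L) :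
    ContMDiffOn 𝓘(ℂ, W) 𝓘(ℂ, E) ω (fun w => g * T.symm (0, w))
      {w | ((0, w) : V × W) ∈ T.target} := by
  have h1 : ContMDiff 𝓘(ℂ, W) 𝓘(ℂ, V × W) ω (fun w : W => ((0, w) : V × W)) :=
    (contDiff_const.prodMk contDiff_id).contMDiff
  exact (contMDiff_mul_left (I := 𝓘(ℂ, E)) (n := ω)).comp_contMDiffOn
    (hT.contMDiffOn_symm.comp h1.contMDiffOn fun _ hx => hx)

theorem isManifold (hT : IsSliceChart (E := E) C T) :
    letI := hT.chartedSpace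
    IsManifold 𝓘(ℂ, W) ω C := by
  let := hT.chartedSpace
  refine isManifold_of_contDiffOn _ _ _ ?_
  rintro _ _ ⟨c, rfl⟩ ⟨c', rfl⟩
  have hset : 𝓘(ℂ, W).symm ⁻¹' ((hT.chart c).symm ≫ₕ hT.chart c').source ∩ range 𝓘(ℂ, W)
      ⊆ {w | w ∈ (hT.chart c).target ∧ (hT.chart c).symm w ∈ (hT.chart c').source} := by
    intro w hw
    exact hw.1
  have hcoe : ∀ w, w ∈ (hT.chart c).target →
      (((hT.chart c).symm w : C) : L) = c * T.symm (0, w) := fun w hw => hT.chart_symm_coe c hw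
  refine ContDiffOn.mono ?_ hset
  rw [← contMDiffOn_iff_contDiffOn]
  refine ContMDiffOn.congr ((hT.contMDiffOn_coord (c' : L)).comp
    ((hT.contMDiffOn_param (c : L)).mono fun w hw => hw.1) ?_) ?_
  · rintro w ⟨hw, hw'⟩
    rw [chart_source, mem_ofPred_eq, hcoe w hw] at hw'
    exact hw'
  · rintro w ⟨hw, -⟩
    change (T ((c' : L)⁻¹ * ((hT.chart c).symm w : C))).2 = _
    rw [hcoe w hw]
    rfl

/-- A map into `C` is holomorphic as soon as it is holomorphic as a map into `L`. -/
theorem contMDiff_of_coe (hT : IsSliceChart (E := E) C T) {E' H' M : Type*}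
    [NormedAddCommGroup E'] [NormedSpace ℂ E'] [TopologicalSpace H'] [TopologicalSpace M]
    [ChartedSpace H' M] {I : ModelWithCorners ℂ E' H'} {u : M → C}
    (hu : ContMDiff I 𝓘(ℂ, E) ω fun m => (u m : L)) :
    letI := hT.chartedSpace
    ContMDiff I 𝓘(ℂ, W) ω u := by
  let := hT.chartedSpace
  intro m
  rw [contMDiffAt_iff_target]
  refine ⟨(Topology.IsInducing.subtypeVal.continuous_iff.2 hu.continuous).continuousAt, ?_⟩
  have h1 := (hT.contMDiffOn_coord (u m : L)).contMDiffAt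
    ((T.open_source.preimage ((contMDiff_mul_left (I := 𝓘(ℂ, E)) (n := ω)
      (a := (u m : L)⁻¹)).continuous)).mem_nhds (hT.mem_chart_source (u m)))
  exact ContMDiffAt.comp (f := fun m => (u m : L)) m h1 (hu m)

/-- A map of real manifolds into `C` is smooth as soon as it is smooth as a map into `L`. -/
theorem contMDiff_real_of_coe (hT : IsSliceChart (E := E) C T) {E' H' M : Type*}
    [NormedAddCommGroup E'] [NormedSpace ℝ E'] [TopologicalSpace H'] [TopologicalSpace M]
    [ChartedSpace H' M] {I : ModelWithCorners ℝ E' H'} {u : M → C}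
    (hu : ContMDiff I 𝓘(ℝ, E) ∞ fun m => (u m : L)) :
    letI := hT.chartedSpace
    ContMDiff I 𝓘(ℝ, W) ∞ u := by
  let := hT.chartedSpace
  intro m
  rw [contMDiffAt_iff_target]
  refine ⟨(Topology.IsInducing.subtypeVal.continuous_iff.2 hu.continuous).continuousAt, ?_⟩
  have h1 := (hT.contMDiffOn_coord (u m : L)).contMDiffAt
    ((T.open_source.preimage ((contMDiff_mul_left (I := 𝓘(ℂ, E)) (n := ω)
      (a := (u m : L)⁻¹)).continuous)).mem_nhds (hT.mem_chart_source (u m)))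
  exact ContMDiffAt.comp (f := fun m => (u m : L)) m h1.restrictScalars_real (hu m)

theorem contMDiff_coe (hT : IsSliceChart (E := E) C T) :
    letI := hT.chartedSpace
    ContMDiff 𝓘(ℂ, W) 𝓘(ℂ, E) ω (Subtype.val : C → L) := by
  let := hT.chartedSpace
  have := hT.isManifold
  intro c
  have h1 : ContMDiffAt 𝓘(ℂ, W) 𝓘(ℂ, W) ω (hT.chart c) c :=
    contMDiffAt_of_mem_maximalAtlas (IsManifold.chart_mem_maximalAtlas (I := 𝓘(ℂ, W)) c)
      (hT.mem_chart_source c)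
  have hopen : IsOpen {w | ((0, w) : V × W) ∈ T.target} := T.open_target.preimage (by fun_prop)
  have h2 := (hT.contMDiffOn_param (c : L)).contMDiffAt
    (hopen.mem_nhds ((hT.chart c).map_source (hT.mem_chart_source c)))
  refine (h2.comp c h1).congr_of_eventuallyEq ?_
  filter_upwards [(hT.chart c).open_source.mem_nhds (hT.mem_chart_source c)] with c' hc'
  have := hT.chart_symm_coe c ((hT.chart c).map_source hc')
  rw [(hT.chart c).left_inv hc'] at this
  exact this

theorem lieGroup (hT : IsSliceChart (E := E) C T) :
    letI := hT.chartedSpace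
    LieGroup 𝓘(ℂ, W) ω C := by
  let := hT.chartedSpace
  have hM := hT.isManifold
  exact
    { hM with
      contMDiff_mul := hT.contMDiff_of_coe
        ((hT.contMDiff_coe.comp contMDiff_fst).mul (hT.contMDiff_coe.comp contMDiff_snd))
      contMDiff_inv := hT.contMDiff_of_coe hT.contMDiff_coe.inv }

end IsSliceChart
end LieSubgroup

/-! ### Holomorphic functions on a universal complexification -/

section Complexification
open Set

/-- The subgroup of right periods of a function on a group. -/
def rightPeriods {L X : Type*} [Group L] (F : L → X) : Subgroup L where
  carrier := {c | ∀ l, F (l * c) = F l}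
  mul_mem' := fun {a b} ha hb l => by rw [← mul_assoc, hb, ha]
  one_mem' := fun l => by rw [mul_one]
  inv_mem' := fun {a} ha l => by rw [← ha (l * a⁻¹), inv_mul_cancel_right]

/-- The group of right periods of a holomorphic function on a complex Lie group has a slice chart.
The translates of the function form a family whose level sets near any point are left translates of
the group of periods. -/
theorem exists_isSliceChart_rightPeriods {E L : Type*} [NormedAddCommGroup E] [NormedSpace ℂ E]
    [FiniteDimensional ℂ E] [TopologicalSpace L] [ChartedSpace E L] [Group L]
    [LieGroup 𝓘(ℂ, E) ω L] {F : L → ℂ} (hF : MDifferentiable 𝓘(ℂ, E) 𝓘(ℂ, ℂ) F) :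
    ∃ (r : ℕ) (W : Submodule ℂ E) (T : OpenPartialHomeomorph L ((Fin r → ℂ) × W)),
      IsSliceChart (E := E) (rightPeriods F) T := by
  have htop := topologicalGroup_of_lieGroup 𝓘(ℂ, E) ω (G := L)
  let φ : OpenPartialHomeomorph L E := chartAt E 1
  have hφ : ContMDiffOn 𝓘(ℂ, E) 𝓘(ℂ, E) ω φ φ.source :=
    contMDiffOn_of_mem_maximalAtlas (IsManifold.chart_mem_maximalAtlas 1)
  have hφs : ContMDiffOn 𝓘(ℂ, E) 𝓘(ℂ, E) ω φ.symm φ.target :=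
    contMDiffOn_symm_of_mem_maximalAtlas (IsManifold.chart_mem_maximalAtlas 1)
  obtain ⟨r, W, T, x₀, hx₀, hTU, hT, hTs, hlevel⟩ :=
    exists_slice_chart φ.open_target ⟨_, φ.map_source (mem_chart_source E 1)⟩
      (fun (l : L) x => F (l * φ.symm x)) fun l => by
        rw [← mdifferentiableOn_iff_differentiableOn]
        exact (hF.comp ((contMDiff_mul_left (I := 𝓘(ℂ, E)) (n := ω) (a := l)).mdifferentiable
          (by simp))).comp_mdifferentiableOn (hφs.mdifferentiableOn (by simp))
  set g₀ : L := φ.symm x₀ with hg₀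
  have hg₀s : g₀ ∈ φ.source := φ.map_target (hTU hx₀)
  have hφg₀ : φ g₀ = x₀ := φ.right_inv (hTU hx₀)
  refine ⟨r, W, (Homeomorph.mulLeft g₀).transOpenPartialHomeomorph (φ ≫ₕ T), ?_, ?_, ?_, ?_⟩
  · change g₀ * 1 ∈ φ.source ∩ φ ⁻¹' T.source
    rw [mul_one]
    exact ⟨hg₀s, by rwa [mem_preimage, hφg₀]⟩
  · exact hT.contMDiffOn.comp (hφ.comp
      (contMDiff_mul_left (I := 𝓘(ℂ, E)) (n := ω) (a := g₀)).contMDiffOn fun g hg => hg.1)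
      fun g hg => hg.2
  · have h := (contMDiff_mul_left (I := 𝓘(ℂ, E)) (n := ω) (a := g₀⁻¹)).comp_contMDiffOn
      (hφs.comp (hTs.contMDiffOn.mono inter_subset_left) fun y hy => hy.2)
    exact h
  · rintro g ⟨hg, hg'⟩
    have hg : g₀ * g ∈ φ.source := hg
    refine Iff.trans ?_ (hlevel (φ (g₀ * g)) hg')
    rw [φ.left_inv hg]
    refine ⟨fun h l => ?_, fun h l => ?_⟩
    · rw [← mul_assoc]; exact h _
    · have := h (l * g₀⁻¹)
      rwa [← mul_assoc, inv_mul_cancel_right] at this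

/-- A holomorphic function on a universal complexification `L` of `K` which is invariant under `K`
is constant: its group of periods is a complex Lie group through which `K → L` factors, so the
universal property makes the identity of `L` factor through it. -/
theorem IsUniversalComplexification.eq_of_right_invariant.{u, w}
    {EK : Type w} [NormedAddCommGroup EK] [NormedSpace ℝ EK]
    {K : Type u} [TopologicalSpace K] [ChartedSpace EK K] [Group K]
    {EL : Type w} [NormedAddCommGroup EL] [NormedSpace ℂ EL] [FiniteDimensional ℂ EL]
    {L : Type u} [TopologicalSpace L] [ChartedSpace EL L] [Group L] [LieGroup 𝓘(ℂ, EL) ω L]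
    [T2Space L] [SecondCountableTopology L] {η : K →* L}
    (hη : IsUniversalComplexification (EK := EK) (EL := EL) η)
    {F : L → ℂ} (hF : MDifferentiable 𝓘(ℂ, EL) 𝓘(ℂ, ℂ) F) (hinv : ∀ l k, F (l * η k) = F l)
    (l : L) : F l = F 1 := by
  obtain ⟨r, W, T, hT⟩ := exists_isSliceChart_rightPeriods hF
  let := hT.chartedSpace
  have := hT.lieGroup
  have : SecondCountableTopology (rightPeriods F) :=
    Topology.IsEmbedding.subtypeVal.secondCountableTopology
  let α : K →* rightPeriods F := η.codRestrict _ fun k l => hinv l k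
  obtain ⟨γ, ⟨hγ, hγα⟩, -⟩ := hη.existsUnique_extension W (rightPeriods F) α
    (hT.contMDiff_real_of_coe hη.smooth)
  obtain ⟨δ, -, hδ⟩ := hη.existsUnique_extension EL L η hη.smooth
  have h1 : (rightPeriods F).subtype.comp γ = δ := hδ _
    ⟨(hT.contMDiff_coe.mdifferentiable (by simp)).comp hγ, by
      rw [MonoidHom.comp_assoc, hγα]; rfl⟩
  have h2 : MonoidHom.id L = δ := hδ _ ⟨mdifferentiable_id, MonoidHom.id_comp η⟩
  have h3 : (γ l : L) = l := DFunLike.congr_fun (h1.trans h2.symm) l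
  have h4 := (γ l).2 1
  rwa [h3, one_mul] at h4

end Complexification

/-! ### The spaces of holomorphic functions and analytic functionals -/

section Bounds
open Set

/-- A linear functional which is bounded on a basic neighbourhood of zero is dominated by the
supremum defining this neighbourhood. -/
theorem norm_le_div_of_forall_norm_lt {X ι : Type*} [AddCommGroup X] [Module ℂ X]
    (Ψ : X →ₗ[ℂ] ℂ) (ev : ι → X →ₗ[ℂ] ℂ) {B : Set ι} {ε : ℝ} (hε : 0 < ε)
    (h : ∀ a, (∀ i ∈ B, ‖ev i a‖ < ε) → ‖Ψ a‖ < 1) {a : X} {s : ℝ} (hs : 0 ≤ s)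
    (ha : ∀ i ∈ B, ‖ev i a‖ ≤ s) : ‖Ψ a‖ ≤ s / ε := by
  rw [le_div_iff₀ hε]
  refine le_of_forall_gt_imp_ge_of_dense fun s' hs' => ?_
  have hs0 : 0 < s' := hs.trans_lt hs'
  have hn : ‖((ε / s' : ℝ) : ℂ)‖ = ε / s' := by
    rw [Complex.norm_real, Real.norm_of_nonneg (by positivity)]
  have := h (((ε / s' : ℝ) : ℂ) • a) fun i hi => by
    rw [map_smul, norm_smul, hn, div_mul_eq_mul_div, div_lt_iff₀ hs0]
    exact mul_lt_mul_of_pos_left ((ha i hi).trans_lt hs') hε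
  rw [map_smul, norm_smul, hn, div_mul_eq_mul_div, div_lt_iff₀ hs0, one_mul] at this
  linarith

theorem hasFDerivAt_of_norm_sub_le_sq {V F : Type*} [NormedAddCommGroup V] [NormedSpace ℂ V]
    [NormedAddCommGroup F] [NormedSpace ℂ F] {f : V → F} {f' : V →L[ℂ] F} {x₀ : V} {δ C : ℝ}
    (hδ : 0 < δ) (h : ∀ v, ‖v‖ < δ → ‖f (x₀ + v) - f x₀ - f' v‖ ≤ C * ‖v‖ ^ 2) :
    HasFDerivAt f f' x₀ := by
  rw [hasFDerivAt_iff_isLittleO_nhds_zero]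
  refine Asymptotics.IsBigO.trans_isLittleO (g := fun v : V => ‖v‖ ^ 2) ?_ ?_
  · refine Asymptotics.IsBigO.of_bound C ?_
    filter_upwards [Metric.ball_mem_nhds (0 : V) hδ] with v hv
    have := h v (mem_ball_zero_iff.1 hv)
    simpa using this
  · simpa using (Asymptotics.isLittleO_norm_pow_id (E' := V) one_lt_two)

end Bounds

namespace HolFun
open Set Metric

variable {E : Type*} [NormedAddCommGroup E] [NormedSpace ℂ E]
  {M : Type*} [TopologicalSpace M] [ChartedSpace E M]

/-- Evaluation at a point, as a linear functional on `𝒪(M)`. -/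
noncomputable def evalₗ (x : M) : HolFun E M →ₗ[ℂ] ℂ where
  toFun f := f.1 x
  map_add' _ _ := rfl
  map_smul' _ _ := rfl

theorem hasBasis_nhds_zero : (𝓝 (0 : HolFun E M)).HasBasis
    (fun p : Set M × ℝ => IsCompact p.1 ∧ 0 < p.2) fun p => {f | ∀ x ∈ p.1, ‖f.1 x‖ < p.2} := by
  have h := nhds_basis_uniformity (x := (0 : C(M, ℂ)))
    (Filter.HasBasis.compactConvergenceUniformity (α := M) (Metric.uniformity_basis_dist (α := ℂ)))
  have h2 := h.comap (Subtype.val : holSubmodule E M → C(M, ℂ))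
  rw [← Submodule.coe_zero (p := holSubmodule E M), ← nhds_induced] at h2
  refine Filter.HasBasis.to_hasBasis h2 (fun p hp => ⟨p, hp, ?_⟩) fun p hp => ⟨p, hp, ?_⟩
  · intro f hf x hx
    simpa [dist_eq_norm] using hf x hx
  · intro f hf x hx
    have := hf x hx
    simpa [dist_eq_norm] using this

/-- The bounded sets of `𝒪(M)` are the families that are uniformly bounded on compact sets. -/
theorem isVonNBounded_iff {B : Set (HolFun E M)} : Bornology.IsVonNBounded ℂ B ↔
    ∀ K : Set M, IsCompact K → ∃ C : ℝ, ∀ f ∈ B, ∀ x ∈ K, ‖f.1 x‖ ≤ C := by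
  rw [hasBasis_nhds_zero.isVonNBounded_iff]
  constructor
  · intro h K hK
    obtain ⟨r, hr⟩ := (absorbs_iff_norm.1 (h (K, 1) ⟨hK, one_pos⟩))
    have hc : ‖((|r| : ℝ) : ℂ)‖ = |r| := by rw [Complex.norm_real, norm_abs_eq_norm]; rfl
    refine ⟨|r|, fun f hf x hx => ?_⟩
    obtain ⟨g, hg, rfl⟩ := hr ((|r| : ℝ) : ℂ) (by rw [hc]; exact le_abs_self r) hf
    change ‖((|r| : ℝ) : ℂ) * g.1 x‖ ≤ _
    rw [norm_mul, hc]
    exact mul_le_of_le_one_right (abs_nonneg _) (hg x hx).le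
  · rintro h ⟨K, ε⟩ ⟨hK, hε⟩
    obtain ⟨C, hC⟩ := h K hK
    refine absorbs_iff_norm.2 ⟨(|C| + 1) / ε, fun c hc f hf => ?_⟩
    have hpos : 0 < (|C| + 1) / ε := by positivity
    have hc0 : c ≠ 0 := norm_pos_iff.1 (hpos.trans_le hc)
    refine ⟨c⁻¹ • f, fun x hx => ?_, smul_inv_smul₀ hc0 f⟩
    change ‖c⁻¹ * f.1 x‖ < ε
    rw [norm_mul, norm_inv, inv_mul_lt_iff₀ (norm_pos_iff.2 hc0)]
    rw [div_le_iff₀ hε] at hc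
    calc ‖f.1 x‖ ≤ |C| := (hC f hf x hx).trans (le_abs_self _)
      _ < |C| + 1 := lt_add_one _
      _ ≤ _ := hc

instance [WeaklyLocallyCompactSpace M] [SigmaCompactSpace M] :
    FirstCountableTopology (HolFun E M) :=
  have : FirstCountableTopology C(M, ℂ) := UniformSpace.firstCountableTopology _
  TopologicalSpace.firstCountableTopology_induced (HolFun E M) C(M, ℂ) Subtype.val

theorem differentiableOn_comp {V : Type*} [NormedAddCommGroup V] [NormedSpace ℂ V] {U : Set V}
    {u : V → M} (hu : MDifferentiableOn 𝓘(ℂ, V) 𝓘(ℂ, E) u U) (f : HolFun E M) :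
    DifferentiableOn ℂ (fun x => f.1 (u x)) U := by
  rw [← mdifferentiableOn_iff_differentiableOn]
  exact MDifferentiable.comp_mdifferentiableOn (I' := 𝓘(ℂ, E)) f.2 hu

/-- A bounded family of holomorphic functions is uniformly bounded near every point of a
parametrized neighbourhood. -/
theorem exists_ball_bound {V : Type*} [NormedAddCommGroup V] [NormedSpace ℂ V]
    [FiniteDimensional ℂ V] {U : Set V} (hU : IsOpen U) {u : V → M}
    (hu : ContinuousOn u U) {x₀ : V} (hx₀ : x₀ ∈ U) :
    ∃ δ > 0, ball x₀ δ ⊆ U ∧ ∃ K : Set M, IsCompact K ∧ ∀ x ∈ ball x₀ δ, u x ∈ K := by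
  have : ProperSpace V := FiniteDimensional.proper ℂ V
  obtain ⟨δ, hδ, h⟩ := Metric.nhds_basis_closedBall.mem_iff.1 (hU.mem_nhds hx₀)
  exact ⟨δ, hδ, ball_subset_closedBall.trans h, u '' closedBall x₀ δ,
    (isCompact_closedBall x₀ δ).image_of_continuousOn (hu.mono h),
    fun x hx => mem_image_of_mem u (ball_subset_closedBall hx)⟩

/-- Cauchy estimate of first order. -/
theorem norm_sub_le_of_ball {V : Type*} [NormedAddCommGroup V] [NormedSpace ℂ V]
    {f : V → ℂ} {x₀ : V} {δ t : ℝ} (hf : DifferentiableOn ℂ f (ball x₀ δ))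
    (ht : ∀ x ∈ ball x₀ δ, ‖f x‖ ≤ t) {v : V} (hv : ‖v‖ < δ) :
    ‖f (x₀ + v) - f x₀‖ ≤ 2 * t / δ * ‖v‖ := by
  have hδ : 0 < δ := (norm_nonneg _).trans_lt hv
  have h := Complex.dist_le_div_mul_dist_of_mapsTo_ball (R₂ := 2 * t) hf (fun x hx => by
    rw [mem_closedBall, dist_eq_norm]
    exact (norm_sub_le _ _).trans (by linarith [ht x hx, ht x₀ (mem_ball_self hδ)]))
    (z := x₀ + v) (by simpa using hv)
  simpa [dist_eq_norm] using h

/-- Cauchy estimate for the derivative. -/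
theorem norm_fderiv_le_of_ball {V : Type*} [NormedAddCommGroup V] [NormedSpace ℂ V]
    {f : V → ℂ} {x₀ : V} {δ t : ℝ} (hδ : 0 < δ) (hf : DifferentiableOn ℂ f (ball x₀ δ))
    (ht : ∀ x ∈ ball x₀ δ, ‖f x‖ ≤ t) : ‖fderiv ℂ f x₀‖ ≤ 2 * t / δ := by
  have ht0 : 0 ≤ t := (norm_nonneg _).trans (ht x₀ (mem_ball_self hδ))
  refine (hf.differentiableAt (ball_mem_nhds _ hδ)).hasFDerivAt.le_of_lip' (by positivity) ?_
  filter_upwards [ball_mem_nhds x₀ hδ] with x hx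
  have := norm_sub_le_of_ball hf ht (v := x - x₀) (by simpa [dist_eq_norm] using hx)
  rwa [add_sub_cancel] at this

end HolFun

namespace AnFun
open Set Metric

section Space

variable {E : Type*} [NormedAddCommGroup E] [NormedSpace ℂ E]
  {M : Type*} [TopologicalSpace M] [ChartedSpace E M]

instance : IsUniformAddGroup (AnFun E M) :=
  inferInstanceAs (IsUniformAddGroup (HolFun E M →L[ℂ] ℂ))

instance : ContinuousSMul ℂ (AnFun E M) :=
  inferInstanceAs (ContinuousSMul ℂ (HolFun E M →L[ℂ] ℂ))

instance : T2Space (AnFun E M) :=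
  inferInstanceAs (T2Space (HolFun E M →L[ℂ] ℂ))

/-- Evaluation of functionals at a function, as a linear functional on `𝒜(M)`. -/
noncomputable def evalₗ (f : HolFun E M) : AnFun E M →ₗ[ℂ] ℂ where
  toFun a := a f
  map_add' _ _ := rfl
  map_smul' _ _ := rfl

/-- A functional on `𝒜(M)` as a continuous linear map on `𝒪(M)`. -/
abbrev toCLM (a : AnFun E M) : HolFun E M →L[ℂ] ℂ := a

theorem hasBasis_nhds_zero : (𝓝 (0 : AnFun E M)).HasBasis
    (fun p : Set (HolFun E M) × ℝ => Bornology.IsVonNBounded ℂ p.1 ∧ 0 < p.2)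
    fun p => {a | ∀ f ∈ p.1, ‖a f‖ < p.2} := by
  have := ContinuousLinearMap.hasBasis_nhds_zero_of_basis (σ := RingHom.id ℂ) (E := HolFun E M)
    (Metric.nhds_basis_ball (x := (0 : ℂ)))
  simp only [mem_ball_zero_iff] at this
  exact this

theorem exists_bound (a : AnFun E M) : ∃ K : Set M, IsCompact K ∧ ∃ C : ℝ, 0 ≤ C ∧
    ∀ f : HolFun E M, ∀ s, 0 ≤ s → (∀ x ∈ K, ‖f.1 x‖ ≤ s) → ‖a f‖ ≤ C * s := by
  have h0 : ∀ᶠ f in 𝓝 (0 : HolFun E M), ‖toCLM a f‖ < 1 := by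
    have hc : Continuous fun f => ‖toCLM a f‖ := (toCLM a).continuous.norm
    exact hc.continuousAt.eventually (gt_mem_nhds (by simp))
  obtain ⟨⟨K, ε⟩, ⟨hK, hε⟩, h⟩ := HolFun.hasBasis_nhds_zero.eventually_iff.1 h0
  refine ⟨K, hK, ε⁻¹, by positivity, fun f s hs hf => ?_⟩
  rw [inv_mul_eq_div]
  exact norm_le_div_of_forall_norm_lt (toCLM a).toLinearMap HolFun.evalₗ hε
    (fun f hf => h hf) hs hf

/-- A linear functional dominated by the supremum over a compact set is continuous. -/
noncomputable def ofBound (l : HolFun E M →ₗ[ℂ] ℂ) (h : ∃ K : Set M, IsCompact K ∧ ∃ C : ℝ,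
    ∀ f : HolFun E M, ∀ s, 0 ≤ s → (∀ x ∈ K, ‖f.1 x‖ ≤ s) → ‖l f‖ ≤ C * s) : AnFun E M :=
  ({ l with
    cont := by
      refine continuous_of_continuousAt_zero l ?_
      obtain ⟨K, hK, C, hC⟩ := h
      rw [ContinuousAt, map_zero, Metric.nhds_basis_ball.tendsto_right_iff]
      intro ε hε
      refine HolFun.hasBasis_nhds_zero.eventually_iff.2
        ⟨(K, ε / (|C| + 1)), ⟨hK, by positivity⟩, fun f hf => ?_⟩
      have := hC f (ε / (|C| + 1)) (by positivity) fun x hx => (hf x hx).le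
      rw [mem_ball_zero_iff]
      refine this.trans_lt ?_
      rw [← mul_div_assoc, div_lt_iff₀ (by positivity), mul_comm]
      gcongr
      exact (le_abs_self C).trans_lt (lt_add_one _) } : HolFun E M →L[ℂ] ℂ)

theorem isCompleteLCS [WeaklyLocallyCompactSpace M] [SigmaCompactSpace M] :
    IsCompleteLCS (AnFun E M) where
  isUniformAddGroup := inferInstance
  continuousSMul := inferInstance
  locallyConvexSpace := by
    refine LocallyConvexSpace.ofBasisZero ℝ (AnFun E M) _ _ hasBasis_nhds_zero ?_
    rintro ⟨B, ε⟩ -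
    intro a ha b hb s t hs ht hst f hf
    have h1 : (s • a + t • b) f = (s : ℂ) * a f + (t : ℂ) * b f := rfl
    rw [h1]
    have := convex_ball (0 : ℂ) ε (mem_ball_zero_iff.2 (ha f hf)) (mem_ball_zero_iff.2 (hb f hf))
      hs ht hst
    simpa using this
  t2Space := inferInstance
  completeSpace := inferInstanceAs (CompleteSpace (HolFun E M →L[ℂ] ℂ))

theorem exists_bound_dual (Ψ : AnFun E M →L[ℂ] ℂ) : ∃ B : Set (HolFun E M),
    Bornology.IsVonNBounded ℂ B ∧ ∃ C : ℝ, 0 ≤ C ∧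
      ∀ a : AnFun E M, ∀ s, 0 ≤ s → (∀ f ∈ B, ‖a f‖ ≤ s) → ‖Ψ a‖ ≤ C * s := by
  have h0 : ∀ᶠ a in 𝓝 (0 : AnFun E M), ‖Ψ a‖ < 1 := by
    exact Ψ.continuous.norm.continuousAt.eventually (gt_mem_nhds (by simp))
  obtain ⟨⟨B, ε⟩, ⟨hB, hε⟩, h⟩ := hasBasis_nhds_zero.eventually_iff.1 h0
  refine ⟨B, hB, ε⁻¹, by positivity, fun a s hs ha => ?_⟩
  rw [inv_mul_eq_div]
  exact norm_le_div_of_forall_norm_lt Ψ.toLinearMap evalₗ hε (fun f hf => h hf) hs ha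

end Space
end AnFun

/-! ### Point evaluations in the space of analytic functionals -/

namespace AnFun
open Set Metric

section Delta

variable {E : Type*} [NormedAddCommGroup E] [NormedSpace ℂ E]
  {M : Type*} [TopologicalSpace M] [ChartedSpace E M]

theorem sub_apply (a b : AnFun E M) (f : HolFun E M) : (a - b) f = a f - b f := rfl

/-- Point evaluations along a holomorphic parametrization are locally Lipschitz, uniformly on
bounded sets of functions. -/
theorem exists_norm_delta_sub_le {V : Type*} [NormedAddCommGroup V] [NormedSpace ℂ V]
    [FiniteDimensional ℂ V] {U : Set V} (hU : IsOpen U) {u : V → M}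
    (hu : MDifferentiableOn 𝓘(ℂ, V) 𝓘(ℂ, E) u U) {x₀ : V} (hx₀ : x₀ ∈ U) {B : Set (HolFun E M)}
    (hB : Bornology.IsVonNBounded ℂ B) :
    ∃ δ > 0, ∃ C > 0, ∀ v, ‖v‖ < δ → ∀ f ∈ B,
      ‖(delta (u (x₀ + v)) - delta (u x₀) : AnFun E M) f‖ ≤ C * ‖v‖ := by
  obtain ⟨δ, hδ, hδU, K, hK, hKu⟩ := HolFun.exists_ball_bound hU hu.continuousOn hx₀
  obtain ⟨t, ht⟩ := HolFun.isVonNBounded_iff.1 hB K hK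
  refine ⟨δ, hδ, 2 * |t| / δ + 1, by positivity, fun v hv f hf => ?_⟩
  have h := HolFun.norm_sub_le_of_ball ((HolFun.differentiableOn_comp hu f).mono hδU)
    (fun x hx => (ht f hf _ (hKu x hx)).trans (le_abs_self t)) hv
  refine h.trans ?_
  gcongr
  linarith

/-- The point evaluations depend continuously on the point, for the strong topology. -/
theorem continuous_delta [FiniteDimensional ℂ E] [IsManifold 𝓘(ℂ, E) 1 M] :
    Continuous (delta : M → AnFun E M) := by
  rw [continuous_iff_continuousAt]
  intro m
  have hu : MDifferentiableOn 𝓘(ℂ, E) 𝓘(ℂ, E) (chartAt E m).symm (chartAt E m).target :=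
    (contMDiffOn_symm_of_mem_maximalAtlas (I := 𝓘(ℂ, E)) (n := 1)
      (IsManifold.chart_mem_maximalAtlas m)).mdifferentiableOn (by simp)
  have hm : m ∈ (chartAt E m).source := mem_chart_source E m
  rw [ContinuousAt, ← tendsto_sub_nhds_zero_iff, hasBasis_nhds_zero.tendsto_right_iff]
  rintro ⟨B, ε⟩ ⟨hB, hε⟩
  obtain ⟨δ, hδ, C, hC, h⟩ := exists_norm_delta_sub_le (chartAt E m).open_target hu
    ((chartAt E m).map_source hm) hB
  have hc : ContinuousAt (fun x => C * ‖chartAt E m x - chartAt E m m‖) m :=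
    continuousAt_const.mul (((chartAt E m).continuousAt hm).sub continuousAt_const).norm
  have hc' : ContinuousAt (fun x => ‖chartAt E m x - chartAt E m m‖) m :=
    (((chartAt E m).continuousAt hm).sub continuousAt_const).norm
  filter_upwards [hc.eventually (gt_mem_nhds
      (show C * ‖chartAt E m m - chartAt E m m‖ < ε by simpa using hε)),
    hc'.eventually (gt_mem_nhds
      (show ‖chartAt E m m - chartAt E m m‖ < δ by simpa using hδ)),
    (chartAt E m).open_source.mem_nhds hm] with x hx hx' hxs f hf
  have := h _ hx' f hf
  rw [add_sub_cancel, (chartAt E m).left_inv hxs, (chartAt E m).left_inv hm] at this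
  exact this.trans_lt hx

/-- A continuous functional on `𝒜(M)` is holomorphic along point evaluations. -/
theorem differentiableAt_apply_delta {V : Type*} [NormedAddCommGroup V] [NormedSpace ℂ V]
    [FiniteDimensional ℂ V] {U : Set V} (hU : IsOpen U) {u : V → M}
    (hu : MDifferentiableOn 𝓘(ℂ, V) 𝓘(ℂ, E) u U) {x₀ : V} (hx₀ : x₀ ∈ U)
    (Ψ : AnFun E M →L[ℂ] ℂ) : DifferentiableAt ℂ (fun x => Ψ (delta (u x))) x₀ := by
  obtain ⟨δ, hδ, hδU, K, hK, hKu⟩ := HolFun.exists_ball_bound hU hu.continuousOn hx₀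
  have hd : ∀ f : HolFun E M, DifferentiableOn ℂ (fun x => f.1 (u x)) (ball x₀ δ) := fun f =>
    (HolFun.differentiableOn_comp hu f).mono hδU
  have hda : ∀ f : HolFun E M, DifferentiableAt ℂ (fun x => f.1 (u x)) x₀ := fun f =>
    (hd f).differentiableAt (ball_mem_nhds _ hδ)
  -- the derivatives of the point evaluation as functionals on `𝒪(M)`
  let d : V → HolFun E M →ₗ[ℂ] ℂ := fun v =>
    { toFun := fun f => fderiv ℂ (fun x => f.1 (u x)) x₀ v
      map_add' := fun f g => by
        change fderiv ℂ ((fun x => f.1 (u x)) + fun x => g.1 (u x)) x₀ v = _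
        rw [fderiv_add (hda f) (hda g)]
        rfl
      map_smul' := fun c f => by
        change fderiv ℂ (c • fun x => f.1 (u x)) x₀ v = _
        rw [fderiv_const_smul (hda f)]
        rfl }
  let D : V →ₗ[ℂ] AnFun E M :=
    { toFun := fun v => ofBound (d v) ⟨K, hK, 2 / δ * ‖v‖, fun f s _ hfs => by
        have h1 := HolFun.norm_fderiv_le_of_ball hδ (hd f) fun x hx => hfs _ (hKu x hx)
        calc ‖d v f‖ ≤ ‖fderiv ℂ (fun x => f.1 (u x)) x₀‖ * ‖v‖ := ContinuousLinearMap.le_opNorm _ _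
          _ ≤ 2 * s / δ * ‖v‖ := by gcongr
          _ = 2 / δ * ‖v‖ * s := by ring⟩
      map_add' := fun v w => DFunLike.ext _ _ fun f =>
        map_add (fderiv ℂ (fun x => f.1 (u x)) x₀) v w
      map_smul' := fun c v => DFunLike.ext _ _ fun f =>
        map_smul (fderiv ℂ (fun x => f.1 (u x)) x₀) c v }
  obtain ⟨B, hB, C, hC, hΨ⟩ := exists_bound_dual Ψ
  obtain ⟨t, ht⟩ := HolFun.isVonNBounded_iff.1 hB K hK
  have hmain : HasFDerivAt (fun x => Ψ (delta (u x)))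
      (LinearMap.toContinuousLinearMap (Ψ.toLinearMap ∘ₗ D)) x₀ := by
    refine hasFDerivAt_of_norm_sub_le_sq (C := C * (4 * |t| / δ ^ 2)) hδ fun v hv => ?_
    have h1 : Ψ (delta (u (x₀ + v))) - Ψ (delta (u x₀)) -
        LinearMap.toContinuousLinearMap (Ψ.toLinearMap ∘ₗ D) v
        = Ψ (delta (u (x₀ + v)) - delta (u x₀) - D v) := by
      rw [map_sub, map_sub]; rfl
    rw [h1, mul_assoc]
    refine hΨ _ _ (by positivity) fun f hf => ?_
    exact holAux_taylor hδ (hd f) (fun x hx => (ht f hf _ (hKu x hx)).trans (le_abs_self t)) hv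
  exact hmain.differentiableAt

/-- Along two holomorphic parametrizations, a continuous bilinear form on `𝒜(M)` is holomorphic:
its increment differs from that of the two partial functions by a quadratic term. -/
theorem differentiableAt_bilin_delta {V : Type*} [NormedAddCommGroup V] [NormedSpace ℂ V]
    [FiniteDimensional ℂ V] {U : Set V} (hU : IsOpen U) {u w : V → M}
    (hu : MDifferentiableOn 𝓘(ℂ, V) 𝓘(ℂ, E) u U) (hw : MDifferentiableOn 𝓘(ℂ, V) 𝓘(ℂ, E) w U)
    {x₀ : V} (hx₀ : x₀ ∈ U) (β : AnFun E M →ₗ[ℂ] AnFun E M →ₗ[ℂ] ℂ)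
    (hβ : Continuous fun p : AnFun E M × AnFun E M => β p.1 p.2) :
    DifferentiableAt ℂ (fun x => β (delta (u x)) (delta (w x))) x₀ := by
  have h0 : ∀ᶠ p in 𝓝 (0 : AnFun E M × AnFun E M), ‖β p.1 p.2‖ < 1 :=
    hβ.norm.continuousAt.eventually (gt_mem_nhds (by simp))
  rw [← Prod.mk_zero_zero, nhds_prod_eq] at h0
  obtain ⟨⟨⟨B₁, ε₁⟩, ⟨B₂, ε₂⟩⟩, ⟨⟨hB₁, hε₁⟩, hB₂, hε₂⟩, h⟩ :=
    (hasBasis_nhds_zero.prod hasBasis_nhds_zero).eventually_iff.1 h0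
  have hbound : ∀ a b : AnFun E M, ∀ s > 0, (∀ f ∈ B₁, ‖a f‖ ≤ s) → (∀ f ∈ B₂, ‖b f‖ ≤ s) →
      ‖β a b‖ ≤ 4 / (ε₁ * ε₂) * s ^ 2 := by
    intro a b s hs ha hb
    have hscale : ∀ (c : AnFun E M) (B : Set (HolFun E M)) (ε : ℝ), 0 < ε → (∀ f ∈ B, ‖c f‖ ≤ s) →
        ∀ f ∈ B, ‖(((ε / (2 * s) : ℝ) : ℂ) • c) f‖ < ε := by
      intro c B ε hε hc f hf
      change ‖((ε / (2 * s) : ℝ) : ℂ) * c f‖ < ε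
      rw [norm_mul, Complex.norm_real, Real.norm_of_nonneg (by positivity)]
      calc ε / (2 * s) * ‖c f‖ ≤ ε / (2 * s) * s := by gcongr; exact hc f hf
        _ = ε / 2 := by field_simp
        _ < ε := half_lt_self hε
    have := @h (((ε₁ / (2 * s) : ℝ) : ℂ) • a, ((ε₂ / (2 * s) : ℝ) : ℂ) • b)
      ⟨hscale a B₁ ε₁ hε₁ ha, hscale b B₂ ε₂ hε₂ hb⟩
    simp only [map_smul, LinearMap.smul_apply, norm_smul, Complex.norm_real] at this
    rw [Real.norm_of_nonneg (by positivity), Real.norm_of_nonneg (by positivity)] at this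
    have h2 : ε₂ / (2 * s) * (ε₁ / (2 * s) * ‖β a b‖) = ε₁ * ε₂ / 4 / s ^ 2 * ‖β a b‖ := by
      field_simp; ring
    rw [h2] at this
    rw [div_mul_eq_mul_div, div_lt_iff₀ (by positivity), div_mul_eq_mul_div,
      div_lt_iff₀ (by positivity)] at this
    rw [div_mul_eq_mul_div, le_div_iff₀ (by positivity)]
    linarith
  obtain ⟨δ₁, hδ₁, C₁, hC₁, h₁⟩ := exists_norm_delta_sub_le hU hu hx₀ hB₁
  obtain ⟨δ₂, hδ₂, C₂, hC₂, h₂⟩ := exists_norm_delta_sub_le hU hw hx₀ hB₂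
  let Ψ₁ : AnFun E M →L[ℂ] ℂ := ⟨β.flip (delta (w x₀)), hβ.comp (continuous_id.prodMk continuous_const)⟩
  let Ψ₂ : AnFun E M →L[ℂ] ℂ := ⟨β (delta (u x₀)), hβ.comp (continuous_const.prodMk continuous_id)⟩
  have hq : HasFDerivAt (fun x => β (delta (u x) - delta (u x₀)) (delta (w x) - delta (w x₀)))
      (0 : V →L[ℂ] ℂ) x₀ := by
    refine hasFDerivAt_of_norm_sub_le_sq (δ := min δ₁ δ₂)
      (C := 4 / (ε₁ * ε₂) * max C₁ C₂ ^ 2) (lt_min hδ₁ hδ₂) fun v hv => ?_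
    rcases eq_or_ne v 0 with rfl | hv0
    · simp
    have hvp : 0 < ‖v‖ := norm_pos_iff.2 hv0
    rw [sub_self, map_zero, LinearMap.zero_apply, sub_zero, _root_.zero_apply,
      sub_zero, mul_assoc, ← mul_pow]
    refine hbound _ _ _ (mul_pos (lt_max_of_lt_left hC₁) hvp) (fun f hf => ?_) fun f hf => ?_
    · refine (h₁ v (hv.trans_le (min_le_left _ _)) f hf).trans ?_
      gcongr; exact le_max_left _ _
    · refine (h₂ v (hv.trans_le (min_le_right _ _)) f hf).trans ?_
      gcongr; exact le_max_right _ _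
  have hsum := ((differentiableAt_apply_delta hU hu hx₀ Ψ₁).add
    (differentiableAt_apply_delta hU hw hx₀ Ψ₂)).add (hq.differentiableAt.sub_const
      (β (delta (u x₀)) (delta (w x₀))))
  refine hsum.congr_of_eventuallyEq (Filter.Eventually.of_forall fun x => ?_)
  change β (delta (u x)) (delta (w x)) = β (delta (u x)) (delta (w x₀)) +
    β (delta (u x₀)) (delta (w x)) + (β (delta (u x) - delta (u x₀)) (delta (w x) - delta (w x₀))
      - β (delta (u x₀)) (delta (w x₀)))
  simp only [map_sub, LinearMap.sub_apply]
  ring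

/-- The point evaluations span a dense subspace of `𝒜(M)`. A functional is approximated, uniformly
on a given bounded (hence equicontinuous) set of functions, with the help of a partition of unity on
a compact set carrying it. -/
theorem eq_zero_of_apply_delta [FiniteDimensional ℂ E] [IsManifold 𝓘(ℂ, E) 1 M] [T2Space M]
    [LocallyCompactSpace M] (Ψ : AnFun E M →L[ℂ] ℂ) (hΨ : ∀ x, Ψ (delta x) = 0) : Ψ = 0 := by
  ext a
  obtain ⟨B, hB, C, hC, hbd⟩ := exists_bound_dual Ψ
  have := holAux_polynormable M
  obtain ⟨b, hb⟩ := StrongDual.exists_extension (holSubmodule E M) (toCLM a)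
  -- `b` is carried by a compact set
  have h0 : ∀ᶠ f in 𝓝 (0 : C(M, ℂ)), ‖b f‖ < 1 :=
    b.continuous.norm.continuousAt.eventually (gt_mem_nhds (by simp))
  obtain ⟨⟨K, ε⟩, ⟨hK, hε⟩, h⟩ := (nhds_basis_uniformity (x := (0 : C(M, ℂ)))
    (Filter.HasBasis.compactConvergenceUniformity (α := M)
      (Metric.uniformity_basis_dist (α := ℂ)))).eventually_iff.1 h0
  have hbK : ∀ f : C(M, ℂ), ∀ s, 0 ≤ s → (∀ x ∈ K, ‖f x‖ ≤ s) → ‖b f‖ ≤ s / ε := by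
    intro f s hs hf
    refine norm_le_div_of_forall_norm_lt b.toLinearMap
      (fun x : M => { toFun := fun f : C(M, ℂ) => f x
                      map_add' := fun _ _ => rfl
                      map_smul' := fun _ _ => rfl }) hε (fun f hf => @h f fun x hx => ?_) hs hf
    simpa [dist_eq_norm] using hf x hx
  have key : ∀ s > 0, ‖Ψ a‖ ≤ C * (s / ε) := by
    intro s hs
    -- a finite cover of `K` on whose members the functions of `B` oscillate by less than `s`
    have hcov : ∀ m : M, ∃ O : Set M, IsOpen O ∧ m ∈ O ∧ ∀ x ∈ O, ∀ f ∈ B,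
        ‖f.1 x - f.1 m‖ ≤ s := by
      intro m
      have h1 : ∀ᶠ x in 𝓝 m, (delta x - delta m : AnFun E M) ∈
          {a : AnFun E M | ∀ f ∈ B, ‖a f‖ < s} := by
        have := tendsto_sub_nhds_zero_iff.2 ((continuous_delta (E := E) (M := M)).tendsto m)
        exact this (hasBasis_nhds_zero.mem_of_mem (i := (B, s)) ⟨hB, hs⟩)
      obtain ⟨O, hO, hOo, hmO⟩ := eventually_nhds_iff.1 h1
      exact ⟨O, hOo, hmO, fun x hx f hf => (hO x hx f hf).le⟩
    choose O hO hmO hOB using hcov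
    obtain ⟨t, htK⟩ := hK.elim_finite_subcover O hO fun x _ => mem_iUnion.2 ⟨x, hmO x⟩
    let pt : Fin t.card → M := fun i => (t.equivFin.symm i : M)
    have hcovK : K ⊆ ⋃ i, O (pt i) := by
      intro x hx
      obtain ⟨m, hm, hxm⟩ := mem_iUnion₂.1 (htK hx)
      refine mem_iUnion.2 ⟨t.equivFin ⟨m, hm⟩, ?_⟩
      simpa [pt] using hxm
    obtain ⟨ρ, hρs, hρ1, hρI, -⟩ :=
      exists_continuous_sum_one_of_isOpen_isCompact (fun i => hO (pt i)) hK hcovK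
    let ρc : Fin t.card → C(M, ℂ) := fun i => ⟨fun x => ((ρ i x : ℝ) : ℂ), by fun_prop⟩
    let a' : AnFun E M := ∑ i, b (ρc i) • delta (pt i)
    have hΨa' : Ψ a' = 0 := by simp [a', hΨ]
    have ha' : ∀ f, a' f = b (∑ i, f.1 (pt i) • ρc i) := by
      intro f
      have h1 : a' f = ∑ i, b (ρc i) * f.1 (pt i) := by
        change evalₗ f a' = _
        rw [map_sum]
        rfl
      rw [h1, map_sum]
      exact Finset.sum_congr rfl fun i _ => by rw [map_smul, smul_eq_mul, mul_comm]
    have hΨa : Ψ a = Ψ (a - a') := by rw [map_sub, hΨa', sub_zero]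
    rw [hΨa]
    refine hbd _ _ (by positivity) fun f hf => ?_
    have hfa : (a - a') f = b (f.1 - ∑ i, f.1 (pt i) • ρc i) := by
      rw [sub_apply, ha', map_sub]
      congr 1
      exact (hb f).symm
    rw [hfa]
    refine hbK _ _ hs.le fun x hx => ?_
    have hsum : ∑ i, ρ i x = 1 := by
      have := hρ1 hx
      simpa using this
    have hexp : (f.1 - ∑ i, f.1 (pt i) • ρc i : C(M, ℂ)) x
        = ∑ i, ((ρ i x : ℝ) : ℂ) * (f.1 x - f.1 (pt i)) := by
      simp only [mul_sub, Finset.sum_sub_distrib, ← Finset.sum_mul]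
      rw [← Complex.ofReal_sum, hsum, ContinuousMap.sub_apply, ContinuousMap.sum_apply]
      simp [ρc, mul_comm]
    rw [hexp]
    calc ‖∑ i, ((ρ i x : ℝ) : ℂ) * (f.1 x - f.1 (pt i))‖
        ≤ ∑ i, ρ i x * s := by
          refine norm_sum_le_of_le _ fun i _ => ?_
          rw [norm_mul, Complex.norm_real, Real.norm_of_nonneg (hρI i x).1]
          rcases eq_or_ne (ρ i x) 0 with h0 | h0
          · simp [h0]
          · exact mul_le_mul_of_nonneg_left
              (hOB _ x (hρs i (subset_tsupport _ h0)) f hf) (hρI i x).1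
      _ = s := by rw [← Finset.sum_mul, hsum, one_mul]
  have hlim : Filter.Tendsto (fun s : ℝ => C * (s / ε)) (𝓝[>] 0) (𝓝 0) := by
    have : Filter.Tendsto (fun s : ℝ => C * (s / ε)) (𝓝 0) (𝓝 (C * (0 / ε))) :=
      Continuous.tendsto (by fun_prop) 0
    simpa using this.mono_left nhdsWithin_le_nhds
  have := ge_of_tendsto hlim (eventually_mem_nhdsWithin.mono key)
  simpa using this

end Delta
end AnFun

/-! ### The convolution algebra -/

namespace AnFun
open Set Metric

section Convolution
open scoped Pointwise

variable {E : Type*} [NormedAddCommGroup E] [NormedSpace ℂ E] [FiniteDimensional ℂ E]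
  {G : Type*} [TopologicalSpace G] [ChartedSpace E G] [Group G] [LieGroup 𝓘(ℂ, E) ω G]

theorem delta_mul (g h : G) : (delta (g * h) : AnFun E G) = delta g * delta h := rfl

omit [FiniteDimensional ℂ E] in
theorem isVonNBounded_translate {B : Set (HolFun E G)} (hB : Bornology.IsVonNBounded ℂ B)
    {K : Set G} (hK : IsCompact K) :
    Bornology.IsVonNBounded ℂ {φ : HolFun E G | ∃ f ∈ B, ∃ g ∈ K, translate f g = φ} := by
  have := continuousMul_of_contMDiffMul 𝓘(ℂ, E) ω (G := G)
  rw [HolFun.isVonNBounded_iff] at hB ⊢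
  intro K' hK'
  obtain ⟨C, hC⟩ := hB (K * K') (hK.mul hK')
  refine ⟨C, ?_⟩
  rintro _ ⟨f, hf, g, hg, rfl⟩ h hh
  exact hC f hf _ (mul_mem_mul hg hh)

theorem continuous_const_mul (a : AnFun E G) : Continuous fun b : AnFun E G => a * b := by
  refine continuous_of_continuousAt_zero (AddMonoidHom.mulLeft a) ?_
  rw [ContinuousAt, map_zero, hasBasis_nhds_zero.tendsto_right_iff]
  rintro ⟨B, ε⟩ ⟨hB, hε⟩
  obtain ⟨K, hK, C, hC, ha⟩ := exists_bound a
  refine hasBasis_nhds_zero.eventually_iff.2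
    ⟨(_, ε / (C + 1)), ⟨isVonNBounded_translate hB hK, by positivity⟩, fun b hb f hf => ?_⟩
  refine (ha (slice b f) (ε / (C + 1)) (by positivity) fun g hg =>
    (hb _ ⟨f, hf, g, hg, rfl⟩).le).trans_lt ?_
  rw [← mul_div_assoc, div_lt_iff₀ (by positivity), mul_comm]
  gcongr
  exact lt_add_one C

theorem continuous_mul_const (b : AnFun E G) : Continuous fun a : AnFun E G => a * b := by
  refine continuous_of_continuousAt_zero (AddMonoidHom.mulRight b) ?_
  rw [ContinuousAt, map_zero, hasBasis_nhds_zero.tendsto_right_iff]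
  rintro ⟨B, ε⟩ ⟨hB, hε⟩
  exact hasBasis_nhds_zero.eventually_iff.2
    ⟨(_, ε), ⟨hB.image (slice b), hε⟩, fun a ha f hf => ha _ (mem_image_of_mem _ hf)⟩

/-- Convolution is jointly continuous. For a bounded set `B` of functions, the countably many bounded
sets of translates `f (g * ·)` with `f ∈ B` and `g` in a member of a compact exhaustion are absorbed
by a single bounded set; on functionals bounded by `1` on it, the functions `slice b f` form a
bounded set. -/
theorem continuous_mul [SigmaCompactSpace G] :
    Continuous fun p : AnFun E G × AnFun E G => p.1 * p.2 := by
  have hmul := continuousMul_of_contMDiffMul 𝓘(ℂ, E) ω (G := G)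
  have : LocallyCompactSpace G := Manifold.locallyCompact_of_finiteDimensional 𝓘(ℂ, E)
  refine continuous_of_continuousAt_zero₂ (AddMonoidHom.mul : AnFun E G →+ AnFun E G →+ AnFun E G)
    ?_ (fun a => (continuous_const_mul a).continuousAt) fun b => (continuous_mul_const b).continuousAt
  rw [ContinuousAt, map_zero, hasBasis_nhds_zero.tendsto_right_iff]
  rintro ⟨B, ε⟩ ⟨hB, hε⟩
  let κ := CompactExhaustion.choice G
  have hbd : ∀ n, ∃ C : ℝ, 1 ≤ C ∧ ∀ f ∈ B, ∀ g ∈ κ n, ∀ h ∈ κ n, ‖f.1 (g * h)‖ ≤ C := by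
    intro n
    obtain ⟨C, hC⟩ := HolFun.isVonNBounded_iff.1 hB _ ((κ.isCompact n).mul (κ.isCompact n))
    exact ⟨max 1 C, le_max_left _ _, fun f hf g hg h hh =>
      (hC f hf _ (mul_mem_mul hg hh)).trans (le_max_right _ _)⟩
  choose C hC1 hC using hbd
  have hC0 : ∀ n, 0 < C n := fun n => one_pos.trans_le (hC1 n)
  have hnorm : ∀ n, ‖((C n)⁻¹ : ℂ)‖ = (C n)⁻¹ := fun n => by
    rw [norm_inv, Complex.norm_real, Real.norm_of_nonneg (hC0 n).le]
  let B₂ : Set (HolFun E G) :=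
    {φ | ∃ n, ∃ f ∈ B, ∃ g ∈ κ n, ((C n)⁻¹ : ℂ) • translate f g = φ}
  have hB₂ : Bornology.IsVonNBounded ℂ B₂ := by
    rw [HolFun.isVonNBounded_iff]
    intro K hK
    obtain ⟨m, hm⟩ := κ.exists_superset_of_isCompact hK
    refine ⟨C m, ?_⟩
    rintro _ ⟨n, f, hf, g, hg, rfl⟩ h hh
    change ‖((C n)⁻¹ : ℂ) * f.1 (g * h)‖ ≤ C m
    rw [norm_mul, hnorm, inv_mul_le_iff₀ (hC0 n)]
    rcases le_total m n with hmn | hnm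
    · refine (hC n f hf g hg h (κ.subset hmn (hm hh))).trans ?_
      exact le_mul_of_one_le_right (hC0 n).le (hC1 m)
    · refine (hC m f hf g (κ.subset hnm hg) h (hm hh)).trans ?_
      exact le_mul_of_one_le_left (hC0 m).le (hC1 n)
  let B₁ : Set (HolFun E G) :=
    {φ | ∃ b : AnFun E G, (∀ ψ ∈ B₂, ‖b ψ‖ < 1) ∧ ∃ f ∈ B, slice b f = φ}
  have hB₁ : Bornology.IsVonNBounded ℂ B₁ := by
    rw [HolFun.isVonNBounded_iff]
    intro K hK
    obtain ⟨m, hm⟩ := κ.exists_superset_of_isCompact hK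
    refine ⟨C m, ?_⟩
    rintro _ ⟨b, hb, f, hf, rfl⟩ g hg
    change ‖b (translate f g)‖ ≤ C m
    have h1 := (hb _ ⟨m, f, hf, g, hm hg, rfl⟩).le
    have h2 : b (((C m)⁻¹ : ℂ) • translate f g) = ((C m)⁻¹ : ℂ) * b (translate f g) :=
      map_smul (toCLM b) _ _
    rw [h2, norm_mul, hnorm, inv_mul_le_iff₀ (hC0 m), mul_one] at h1
    exact h1
  rw [nhds_prod_eq]
  refine (hasBasis_nhds_zero.prod hasBasis_nhds_zero).eventually_iff.2
    ⟨((B₁, ε), (B₂, 1)), ⟨⟨hB₁, hε⟩, hB₂, one_pos⟩, ?_⟩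
  rintro ⟨a, b⟩ ⟨ha, hb⟩ f hf
  exact ha _ ⟨b, hb, f, hf, rfl⟩

theorem isHatAlgebra [SigmaCompactSpace G] : IsHatAlgebra (AnFun E G) :=
  have : LocallyCompactSpace G := Manifold.locallyCompact_of_finiteDimensional 𝓘(ℂ, E)
  { isCompleteLCS with continuous_mul := continuous_mul }

variable {E' : Type*} [NormedAddCommGroup E'] [NormedSpace ℂ E'] [FiniteDimensional ℂ E']
  {G' : Type*} [TopologicalSpace G'] [ChartedSpace E' G'] [Group G'] [LieGroup 𝓘(ℂ, E') ω G']

theorem continuous_map (ι : G →* G') (hι : MDifferentiable 𝓘(ℂ, E) 𝓘(ℂ, E') ι) :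
    Continuous (map ι hι) :=
  (ContinuousLinearMap.precomp ℂ (pullback ι hι)).continuous

end Convolution
end AnFun

/-! ### Averaging over a compact group in a complete locally convex space -/

section Average
open Set MeasureTheory

/-- The weak integral of a continuous function on a compact space with values in a complete locally
convex space exists: the closed convex hull of its range is compact, and contains a point with
prescribed finitely many coordinates since this is true in finite dimensions. -/
theorem exists_weak_integral {K Y : Type*} [TopologicalSpace K] [CompactSpace K]
    [MeasurableSpace K] [BorelSpace K] (μ : Measure K) [IsProbabilityMeasure μ]
    [AddCommGroup Y] [Module ℂ Y] [UniformSpace Y] (hY : IsCompleteLCS Y)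
    {Φ : K → Y} (hΦ : Continuous Φ) :
    ∃ y : Y, ∀ l : Y →L[ℂ] ℂ, l y = ∫ k, l (Φ k) ∂μ := by
  have := hY.isUniformAddGroup
  have := hY.continuousSMul
  have := hY.locallyConvexSpace
  have := hY.completeSpace
  have : ContinuousSMul ℝ Y := IsScalarTower.continuousSMul ℂ
  let S : Set Y := closure (convexHull ℝ (range Φ))
  have hSc : IsCompact S :=
    TotallyBounded.isCompact_of_isClosed
      ((isCompact_range hΦ).totallyBounded.convexHull.closure) isClosed_closure
  have hconv : Convex ℝ S := (convex_convexHull ℝ _).closure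
  have hmem : ∀ k, Φ k ∈ S := fun k => subset_closure (subset_convexHull ℝ _ (mem_range_self k))
  obtain ⟨y, -, hy⟩ := hSc.inter_iInter_nonempty
    (fun l : Y →L[ℂ] ℂ => {y | l y = ∫ k, l (Φ k) ∂μ})
    (fun l => isClosed_eq l.continuous continuous_const) fun u => by
      let Λ : Y →L[ℝ] (u → ℂ) := ContinuousLinearMap.pi fun i => (i.1).restrictScalars ℝ
      have hi : Integrable (fun k => Λ (Φ k)) μ :=
        (Λ.continuous.comp hΦ).integrable_of_hasCompactSupport (HasCompactSupport.of_compactSpace _)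
      obtain ⟨y, hyS, hy⟩ : ∫ k, Λ (Φ k) ∂μ ∈ Λ '' S :=
        (hconv.linear_image Λ.toLinearMap).integral_mem (hSc.image Λ.continuous).isClosed
          (Filter.Eventually.of_forall fun k => mem_image_of_mem _ (hmem k)) hi
      refine ⟨y, hyS, mem_iInter₂.2 fun l hl => ?_⟩
      have h1 := congrFun hy ⟨l, hl⟩
      rw [eval_integral fun i => Integrable.eval hi i] at h1
      exact h1
  exact ⟨y, fun l => mem_iInter.1 hy l⟩

theorem eq_of_forall_clm_eq {Y : Type*} [AddCommGroup Y] [Module ℂ Y] [UniformSpace Y]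
    (hY : IsCompleteLCS Y) {y z : Y} (h : ∀ l : Y →L[ℂ] ℂ, l y = l z) : y = z := by
  have := hY.isUniformAddGroup
  have := hY.continuousSMul
  have := hY.locallyConvexSpace
  have := hY.t2Space
  by_contra hne
  obtain ⟨f, hf⟩ := RCLike.geometric_hahn_banach_point_point (𝕜 := ℂ) hne
  rw [h f] at hf
  exact hf.false

end Average

/-! ### Conjugation on bimodules over the convolution algebra -/

namespace IsHatBimodule
open Set MeasureTheory AnFun

section Conjugation

variable {E : Type*} [NormedAddCommGroup E] [NormedSpace ℂ E] [FiniteDimensional ℂ E]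
  {G : Type*} [TopologicalSpace G] [ChartedSpace E G] [Group G] [LieGroup 𝓘(ℂ, E) ω G]
  {Y : Type*} [AddCommGroup Y] [Module ℂ Y] [UniformSpace Y] [Module (AnFun E G) Y]
  [Module (AnFun E G)ᵐᵒᵖ Y]

/-- The left action of an element of the algebra, as a continuous operator. -/
noncomputable def lsmulCLM (hY : IsHatBimodule (AnFun E G) (AnFun E G) Y) (a : AnFun E G) :
    Y →L[ℂ] Y where
  toFun y := a • y
  map_add' := smul_add a
  map_smul' c y := by
    have := hY.isScalarTower_left
    exact smul_comm a c y
  cont := hY.continuous_left.comp (continuous_const.prodMk continuous_id)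

/-- The right action of an element of the algebra, as a continuous operator. -/
noncomputable def rsmulCLM (hY : IsHatBimodule (AnFun E G) (AnFun E G) Y) (a : AnFun E G) :
    Y →L[ℂ] Y where
  toFun y := MulOpposite.op a • y
  map_add' := smul_add _
  map_smul' c y := by
    have := hY.isScalarTower_right
    exact smul_comm (MulOpposite.op a) c y
  cont := hY.continuous_right.comp (continuous_id.prodMk continuous_const)

/-- The operator `y ↦ δ_g y δ_{g⁻¹}` on a bimodule over `𝒜(G)`. -/
noncomputable def conj (hY : IsHatBimodule (AnFun E G) (AnFun E G) Y) (g : G) : Y →L[ℂ] Y :=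
  (hY.rsmulCLM (delta g⁻¹)).comp (hY.lsmulCLM (delta g))

theorem conj_apply (hY : IsHatBimodule (AnFun E G) (AnFun E G) Y) (g : G) (y : Y) :
    hY.conj g y = MulOpposite.op (delta g⁻¹ : AnFun E G) • (delta g : AnFun E G) • y := rfl

theorem conj_mul (hY : IsHatBimodule (AnFun E G) (AnFun E G) Y) (g h : G) (y : Y) :
    hY.conj (g * h) y = hY.conj g (hY.conj h y) := by
  have := hY.smulCommClass
  rw [conj_apply, conj_apply, conj_apply, mul_inv_rev, delta_mul, delta_mul, MulOpposite.op_mul,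
    mul_smul, mul_smul, smul_comm (delta g : AnFun E G) (MulOpposite.op (delta h⁻¹ : AnFun E G))]

theorem conj_eq_iff (hY : IsHatBimodule (AnFun E G) (AnFun E G) Y) {g : G} {y : Y} :
    hY.conj g y = y ↔
      (delta g : AnFun E G) • y = MulOpposite.op (delta g : AnFun E G) • y := by
  have h1 : ∀ z : Y, MulOpposite.op (delta g⁻¹ : AnFun E G) •
      MulOpposite.op (delta g : AnFun E G) • z = z := fun z => by
    rw [smul_smul, ← MulOpposite.op_mul, ← delta_mul, mul_inv_cancel]
    exact one_smul _ z
  have h2 : ∀ z : Y, MulOpposite.op (delta g : AnFun E G) •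
      MulOpposite.op (delta g⁻¹ : AnFun E G) • z = z := fun z => by
    rw [smul_smul, ← MulOpposite.op_mul, ← delta_mul, inv_mul_cancel]
    exact one_smul _ z
  rw [conj_apply]
  constructor
  · intro h
    have := congrArg (fun z => MulOpposite.op (delta g : AnFun E G) • z) h
    simpa only [h2] using this
  · intro h
    rw [h, h1]

/-- An element commuting with all point evaluations commutes with the whole algebra. -/
theorem smul_eq_op_smul_of_conj_eq [T2Space G] (hY : IsHatBimodule (AnFun E G) (AnFun E G) Y)
    {y : Y} (hy : ∀ g, hY.conj g y = y) (a : AnFun E G) : a • y = MulOpposite.op a • y := by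
  have : LocallyCompactSpace G := Manifold.locallyCompact_of_finiteDimensional 𝓘(ℂ, E)
  have : IsManifold 𝓘(ℂ, E) 1 G := IsManifold.of_le (n := ω) (by simp)
  have := hY.isScalarTower_left
  have := hY.isScalarTower_right
  refine eq_of_forall_clm_eq hY.toIsCompleteLCS fun l => ?_
  let Ψ : AnFun E G →L[ℂ] ℂ :=
    { toFun := fun a => l (a • y) - l (MulOpposite.op a • y)
      map_add' := fun a b => by
        rw [add_smul, MulOpposite.op_add, add_smul, map_add, map_add]; ring
      map_smul' := fun c a => by
        rw [MulOpposite.op_smul, smul_assoc, smul_assoc, map_smul l c, map_smul l c, RingHom.id_apply,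
          smul_sub]
      cont := (l.continuous.comp (hY.continuous_left.comp
        (continuous_id.prodMk continuous_const))).sub (l.continuous.comp
          (hY.continuous_right.comp (continuous_const.prodMk continuous_id))) }
  have hΨ := eq_zero_of_apply_delta Ψ fun g => by
    change l (delta g • y) - l (MulOpposite.op (delta g) • y) = 0
    rw [hY.conj_eq_iff.1 (hy g), sub_self]
  exact sub_eq_zero.1 (DFunLike.congr_fun hΨ a)

/-- The coefficients of the conjugation representation are holomorphic along holomorphic
homomorphisms. -/
theorem mdifferentiable_conj (hY : IsHatBimodule (AnFun E G) (AnFun E G) Y)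
    {E' : Type*} [NormedAddCommGroup E'] [NormedSpace ℂ E'] [FiniteDimensional ℂ E']
    {L : Type*} [TopologicalSpace L] [ChartedSpace E' L] [Group L] [LieGroup 𝓘(ℂ, E') ω L]
    {ι : L →* G} (hι : MDifferentiable 𝓘(ℂ, E') 𝓘(ℂ, E) ι) (y : Y) (l : Y →L[ℂ] ℂ) :
    MDifferentiable 𝓘(ℂ, E') 𝓘(ℂ, ℂ) fun x => l (hY.conj (ι x) y) := by
  have htop := topologicalGroup_of_lieGroup 𝓘(ℂ, E') ω (G := L)
  have := hY.smulCommClass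
  have := hY.isScalarTower_left
  have := hY.isScalarTower_right
  have : IsManifold 𝓘(ℂ, E) 1 G := IsManifold.of_le (n := ω) (by simp)
  have : IsManifold 𝓘(ℂ, E') 1 L := IsManifold.of_le (n := ω) (by simp)
  let β : AnFun E G →ₗ[ℂ] AnFun E G →ₗ[ℂ] ℂ :=
    LinearMap.mk₂ ℂ (fun a b => l (MulOpposite.op b • a • y))
      (fun a a' b => by rw [add_smul, smul_add, map_add])
      (fun c a b => by
        rw [smul_assoc, smul_comm (MulOpposite.op b) c, map_smul l c])
      (fun a b b' => by rw [MulOpposite.op_add, add_smul, map_add])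
      (fun c a b => by rw [MulOpposite.op_smul, smul_assoc, map_smul l c])
  have hβ : Continuous fun p : AnFun E G × AnFun E G => β p.1 p.2 :=
    l.continuous.comp (hY.continuous_right.comp ((hY.continuous_left.comp
      (continuous_fst.prodMk continuous_const)).prodMk continuous_snd))
  have hinv : MDifferentiable 𝓘(ℂ, E') 𝓘(ℂ, E) fun x : L => ι x⁻¹ :=
    hι.comp ((contMDiff_inv 𝓘(ℂ, E') ω (G := L)).mdifferentiable (by simp))
  have hF : ∀ x, l (hY.conj (ι x) y) = β (delta (ι x)) (delta (ι x⁻¹)) := fun x => by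
    rw [map_inv]; rfl
  simp only [hF]
  intro x₀
  rw [mdifferentiableAt_iff]
  constructor
  · have hd := continuous_delta (E := E) (M := G)
    exact (hβ.comp ((hd.comp hι.continuous).prodMk (hd.comp hinv.continuous))).continuousAt
  · have hs : MDifferentiableOn 𝓘(ℂ, E') 𝓘(ℂ, E') (extChartAt 𝓘(ℂ, E') x₀).symm
        (extChartAt 𝓘(ℂ, E') x₀).target :=
      (contMDiffOn_extChartAt_symm (I := 𝓘(ℂ, E')) (n := 1) x₀).mdifferentiableOn (by simp)
    exact (differentiableAt_bilin_delta (isOpen_extChartAt_target (I := 𝓘(ℂ, E')) x₀)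
      (hι.comp_mdifferentiableOn hs) (hinv.comp_mdifferentiableOn hs)
      (mem_extChartAt_target (I := 𝓘(ℂ, E')) x₀) β hβ).differentiableWithinAt

/-- Averaging over a compact group `K`: given a continuous homomorphism `κ : K → G` and a vector `s`,
there is a weak integral of `κ k ↦ δ_{κ k} s δ_{κ k}⁻¹`; it is invariant under conjugation by
`κ K`, and every continuous linear map constant on these conjugates takes the same value on it. -/
theorem exists_average (hY : IsHatBimodule (AnFun E G) (AnFun E G) Y)
    {K : Type*} [TopologicalSpace K] [Group K] [IsTopologicalGroup K] [CompactSpace K]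
    {κ : K →* G} (hκ : Continuous κ) (s : Y) :
    ∃ y : Y, (∀ k, hY.conj (κ k) y = y) ∧
      ∀ {Z : Type*} [AddCommGroup Z] [Module ℂ Z] [UniformSpace Z], IsCompleteLCS Z →
        ∀ (T : Y →L[ℂ] Z) (z : Z), (∀ k, T (hY.conj (κ k) s) = z) → T y = z := by
  have : IsManifold 𝓘(ℂ, E) 1 G := IsManifold.of_le (n := ω) (by simp)
  let : MeasurableSpace K := borel K
  have : BorelSpace K := ⟨rfl⟩
  let μ : Measure K := Measure.haarMeasure ⊤
  have hμ : IsProbabilityMeasure μ := ⟨Measure.haarMeasure_self⟩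
  have hΦ : Continuous fun k => hY.conj (κ k) s := by
    have hd := (continuous_delta (E := E) (M := G)).comp hκ
    have hd' : Continuous fun k => (delta (κ k)⁻¹ : AnFun E G) := by
      have := hd.comp (continuous_inv (G := K))
      simpa only [Function.comp_def, map_inv] using this
    exact hY.continuous_right.comp ((hY.continuous_left.comp
      (hd.prodMk continuous_const)).prodMk hd')
  obtain ⟨y, hy⟩ := exists_weak_integral μ hY.toIsCompleteLCS hΦ
  refine ⟨y, fun k => eq_of_forall_clm_eq hY.toIsCompleteLCS fun l => ?_, ?_⟩
  · calc l (hY.conj (κ k) y) = ∫ k', l (hY.conj (κ k) (hY.conj (κ k') s)) ∂μ :=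
          hy (l.comp (hY.conj (κ k)))
      _ = ∫ k', l (hY.conj (κ (k * k')) s) ∂μ := by simp only [map_mul, conj_mul]
      _ = ∫ k', l (hY.conj (κ k') s) ∂μ :=
          integral_mul_left_eq_self (fun k' => l (hY.conj (κ k') s)) k
      _ = l y := (hy l).symm
  · intro Z _ _ _ hZ T z hT
    refine eq_of_forall_clm_eq hZ fun l => ?_
    have h1 := hy (l.comp T)
    simp only [ContinuousLinearMap.comp_apply, hT] at h1
    rw [h1, integral_const, probReal_univ, one_smul]

end Conjugation
end IsHatBimodule

/-! ### Semidirect products -/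

namespace IsHolSemidirectProduct

variable {EN EL EG : Type*} [NormedAddCommGroup EN] [NormedSpace ℂ EN]
    [NormedAddCommGroup EL] [NormedSpace ℂ EL] [NormedAddCommGroup EG] [NormedSpace ℂ EG]
    {N L G : Type*} [TopologicalSpace N] [ChartedSpace EN N] [Group N]
    [TopologicalSpace L] [ChartedSpace EL L] [Group L]
    [TopologicalSpace G] [ChartedSpace EG G] [Group G]
    {φ : L →* MulAut N} {e : N ⋊[φ] L ≃* G}

theorem mdifferentiable_inr (he : IsHolSemidirectProduct EN EL EG e) :
    MDifferentiable 𝓘(ℂ, EL) 𝓘(ℂ, EG) (e.toMonoidHom.comp SemidirectProduct.inr) :=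
  he.mdifferentiable.comp (mdifferentiable_const.prodMk mdifferentiable_id)

theorem isEmbedding_inl (he : IsHolSemidirectProduct EN EL EG e) :
    Topology.IsEmbedding (e.toMonoidHom.comp SemidirectProduct.inl : N →* G) :=
  Function.LeftInverse.isEmbedding (f := fun g => (e.symm g).left)
    (fun n => by simp) (continuous_fst.comp he.mdifferentiable_symm.continuous)
    he.mdifferentiable_inl.continuous

theorem isEmbedding_inr (he : IsHolSemidirectProduct EN EL EG e) :
    Topology.IsEmbedding (e.toMonoidHom.comp SemidirectProduct.inr : L →* G) :=
  Function.LeftInverse.isEmbedding (f := fun g => (e.symm g).right)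
    (fun n => by simp) (continuous_snd.comp he.mdifferentiable_symm.continuous)
    he.mdifferentiable_inr.continuous

end IsHolSemidirectProduct

/-- Conjugation by elements of `L` in `G = N ⋊ L` preserves `N`. -/
theorem SemidirectProduct.exists_inl_mul_inr {N L G : Type*} [Group N] [Group L] [Group G]
    {φ : L →* MulAut N} (e : N ⋊[φ] L ≃* G) (n : N) (l : L) :
    ∃ n', e (inl n) * e (inr l) = e (inr l) * e (inl n') :=
  ⟨(φ l)⁻¹ n, by rw [← map_mul, ← map_mul, inl_aut_inv, ← mul_assoc, ← mul_assoc,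
    ← map_mul inr, mul_inv_cancel, map_one, one_mul]⟩

/-- Averaging an element over the compact real form of `L` produces a central element with the same
image, provided that the element commutes with `𝒜(N)` and its image is central. -/
theorem IsHolSemidirectProduct.exists_central_lift
    {EN : Type*} [NormedAddCommGroup EN] [NormedSpace ℂ EN]
    {EL : Type*} [NormedAddCommGroup EL] [NormedSpace ℂ EL] [FiniteDimensional ℂ EL]
    {EG : Type*} [NormedAddCommGroup EG] [NormedSpace ℂ EG] [FiniteDimensional ℂ EG]
    {N : Type*} [TopologicalSpace N] [ChartedSpace EN N] [Group N]
    {L : Type*} [TopologicalSpace L] [ChartedSpace EL L] [Group L] [LieGroup 𝓘(ℂ, EL) ω L]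
    {G : Type*} [TopologicalSpace G] [ChartedSpace EG G] [Group G] [LieGroup 𝓘(ℂ, EG) ω G]
    [T2Space G] [SecondCountableTopology G]
    {φ : L →* MulAut N} {e : N ⋊[φ] L ≃* G} (he : IsHolSemidirectProduct EN EL EG e)
    (hL : IsLinearlyComplexReductive EL L) {Y Z : Type v}
    [AddCommGroup Y] [Module ℂ Y] [UniformSpace Y] [Module (AnFun EG G) Y]
    [Module (AnFun EG G)ᵐᵒᵖ Y]
    [AddCommGroup Z] [Module ℂ Z] [UniformSpace Z] [Module (AnFun EG G) Z]
    [Module (AnFun EG G)ᵐᵒᵖ Z]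
    (hY : IsHatBimodule (AnFun EG G) (AnFun EG G) Y)
    (hZ : IsHatBimodule (AnFun EG G) (AnFun EG G) Z) (π : Y →L[ℂ] Z)
    (hπ : IsBimoduleMap (AlgHom.id ℂ (AnFun EG G)) (AlgHom.id ℂ (AnFun EG G)) π) {s : Y}
    (hs : ∀ n, hY.conj (e (SemidirectProduct.inl n)) s = s) (hz : ∀ g, hZ.conj g (π s) = π s) :
    ∃ y : Y, π y = π s ∧ ∀ a : AnFun EG G, a • y = MulOpposite.op a • y := by
  obtain ⟨EK, _, _, _, K, _, _, _, _, _, _, η, hη⟩ := hL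
  have : IsTopologicalGroup K := topologicalGroup_of_lieGroup 𝓘(ℝ, EK) ∞
  have := he.isEmbedding_inr.t2Space
  have := he.isEmbedding_inr.secondCountableTopology
  let ι : L →* G := e.toMonoidHom.comp SemidirectProduct.inr
  obtain ⟨y, hyK, hy⟩ := hY.exists_average (κ := ι.comp η)
    (he.mdifferentiable_inr.continuous.comp hη.smooth.continuous) s
  have hN : ∀ n, hY.conj (e (SemidirectProduct.inl n)) y = y := by
    intro n
    have := hY.isUniformAddGroup
    have h0 := hy hY.toIsCompleteLCS
      (hY.conj (e (SemidirectProduct.inl n)) - ContinuousLinearMap.id ℂ Y) 0 fun k => by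
        obtain ⟨n', hn'⟩ := SemidirectProduct.exists_inl_mul_inr e n (η k)
        have h1 : hY.conj (e (SemidirectProduct.inl n)) (hY.conj (ι (η k)) s)
            = hY.conj (ι (η k)) s := by
          rw [← hY.conj_mul]
          refine (congrArg (fun g => hY.conj g s) hn').trans ?_
          rw [hY.conj_mul, hs]
          rfl
        exact sub_eq_zero.2 h1
    exact sub_eq_zero.1 h0
  have hLy : ∀ l, hY.conj (ι l) y = y := by
    intro l
    refine eq_of_forall_clm_eq hY.toIsCompleteLCS fun lam => ?_
    have h1 := hη.eq_of_right_invariant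
      (hY.mdifferentiable_conj he.mdifferentiable_inr y lam) (fun l k => by
        rw [map_mul, hY.conj_mul]
        exact congrArg (fun u => lam (hY.conj (ι l) u)) (hyK k)) l
    have h2 : hY.conj (ι 1) y = y := by
      have := hyK 1
      rwa [map_one, ← map_one ι] at this
    exact h1.trans (congrArg lam h2)
  have hπconj : ∀ g u, π (hY.conj g u) = hZ.conj g (π u) := by
    intro g u
    exact (hπ.2 _ _).trans (congrArg (fun v => MulOpposite.op (AnFun.delta g⁻¹ : AnFun EG G) • v)
      (hπ.1 (AnFun.delta g) u))
  refine ⟨y, hy hZ.toIsCompleteLCS π _ fun k => (hπconj _ _).trans (hz _),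
    hY.smul_eq_op_smul_of_conj_eq fun g => ?_⟩
  have hg : g = e (SemidirectProduct.inl (e.symm g).left) *
      e (SemidirectProduct.inr (e.symm g).right) := by
    rw [← map_mul, SemidirectProduct.inl_left_mul_inr_right, e.apply_symm_apply]
  rw [hg, hY.conj_mul]
  exact (congrArg _ (hLy _)).trans (hN _)

theorem mainTheorem6
    {EN : Type*} [NormedAddCommGroup EN] [NormedSpace ℂ EN] [FiniteDimensional ℂ EN]
    {EL : Type*} [NormedAddCommGroup EL] [NormedSpace ℂ EL] [FiniteDimensional ℂ EL]
    {EG : Type*} [NormedAddCommGroup EG] [NormedSpace ℂ EG] [FiniteDimensional ℂ EG]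
    {N : Type*} [TopologicalSpace N] [ChartedSpace EN N] [Group N] [LieGroup 𝓘(ℂ, EN) ω N]
    {L : Type*} [TopologicalSpace L] [ChartedSpace EL L] [Group L] [LieGroup 𝓘(ℂ, EL) ω L]
    {G : Type*} [TopologicalSpace G] [ChartedSpace EG G] [Group G] [LieGroup 𝓘(ℂ, EG) ω G]
    [T2Space G] [SecondCountableTopology G]
    {φ : L →* MulAut N} (e : N ⋊[φ] L ≃* G) (he : IsHolSemidirectProduct EN EL EG e)
    (hL : IsLinearlyComplexReductive EL L) :
    IsRelHomTrivial.{v} (R := AnFun EN N) (A := AnFun EG G)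
      (AnFun.map (e.toMonoidHom.comp SemidirectProduct.inl) he.mdifferentiable_inl) := by
  have hNl : LocallyCompactSpace N := Manifold.locallyCompact_of_finiteDimensional 𝓘(ℂ, EN)
  have hGl : LocallyCompactSpace G := Manifold.locallyCompact_of_finiteDimensional 𝓘(ℂ, EG)
  have hN2 := he.isEmbedding_inl.secondCountableTopology
  refine ⟨⟨AnFun.isHatAlgebra, AnFun.isHatAlgebra, AnFun.continuous_map _ _⟩, ?_⟩
  intro Y Z _ _ _ _ _ _ _ _ _ _ hY hZ π σ f hπ hσ hπσ hf
  -- `f 1` is central, and its image under the section commutes with the image of `𝒜(N)`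
  have hcentral : ∀ a : AnFun EG G, a • f 1 = MulOpposite.op a • f 1 := fun a => by
    have h1 : f (a • 1) = a • f 1 := hf.1 a 1
    have h2 : f (MulOpposite.op a • 1) = MulOpposite.op a • f 1 := hf.2 a 1
    rw [← h1, ← h2, smul_eq_mul, mul_one, op_smul_eq_mul, one_mul]
  have hs : ∀ n, hY.conj (e (SemidirectProduct.inl n)) (σ (f 1)) = σ (f 1) := fun n =>
    hY.conj_eq_iff.2 <| ((hσ.1 (AnFun.delta n) (f 1)).symm.trans
      (congrArg σ (hcentral _))).trans (hσ.2 (AnFun.delta n) (f 1))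
  obtain ⟨y, hy, hya⟩ := he.exists_central_lift hL hY hZ π hπ hs fun g => by
    rw [hπσ]
    exact hZ.conj_eq_iff.2 (hcentral _)
  rw [hπσ] at hy
  have := hY.isScalarTower_left
  refine ⟨⟨LinearMap.toSpanSingleton (AnFun EG G) Y y |>.restrictScalars ℂ,
    hY.continuous_left.comp (continuous_id.prodMk continuous_const)⟩,
    ⟨fun r x => mul_smul r x y, fun r x => ?_⟩, fun x => ?_⟩
  · have := hY.smulCommClass
    change (x * r) • y = MulOpposite.op r • x • y
    rw [mul_smul, hya r, smul_comm]
  · have h1 : f (x • 1) = x • f 1 := hf.1 x 1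
    rw [smul_eq_mul, mul_one] at h1
    exact (hπ.1 x y).trans ((congrArg (x • ·) hy).trans h1.symm)
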